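/- For $a,b\in\mathbb{R}^2$ let $[a,b]$ be the determinant of the matrix with columns $a,b$. Consider a norm on $\mathbb{R}^2$ with unit ball $U$ of area $A_U$, whose unit circle has a piecewise smooth counterclockwise parameterization $u:\mathbb{R}\to\partial U$ which is bijective from $[0,2T)$ onto $\partial U$ and satisfies $u(t+T)=-u(t)$: there are break points $0=t_0<t_1<\dots<t_n=T$, extended by $t_{i+n}=t_i+T$, such that on each $[t_i,t_{i+1}]$ the map $u$ is $C^\infty$ with $u'\neq 0$, and the arc $u([t_i,t_{i+1}])$ is either a straight segment or strictly convex with $[u',u'']\ne 0$; two consecutive straight segments do not lie on one line. Put $v=u'/[u,u']$ inside the arcs. An *admissible curve* is a closed ($2T$-periodic) curve $\gamma:\mathbb{R}\to\mathbb{R}^2$ that is $C^\infty$ on each $[t_i,t_{i+1}]$ and satisfies $\gamma'(t)=r(t)u'(t)$ inside each arc for a scalar function $r$, where $r$ is constant on every arc on which $u$ is a straight segment. It is *convex* if it lies on the boundary of its convex hull. It is *symmetric* if there is a point $p$ with $\gamma(t+T)-p=-(\gamma(t)-p)$ for all $t$, and it has *constant width* if $[\gamma,v](t+T)+[\gamma,v](t)$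 is the same constant for all $t$ inside the arcs. Let $$L_*(\gamma)=\int_0^{2T} r\,[u,u']\,dt,\qquad w_\gamma=\frac{L_*(\gamma)}{A_U},$$ $$WC(\gamma)(t)=\tfrac12\big(\gamma(t)+\gamma(t+T)\big),\qquad CWMS(\gamma)(t)=\tfrac12\big(\gamma(t)-\gamma(t+T)-w_\gamma u(t)\big),$$ and let the signed areas be $$A_\gamma=\tfrac12\int_0^{2T}[\gamma,\gamma']\,dt,\qquad A_{CWMS(\gamma)}=\tfrac12\int_0^{2T}[CWMS(\gamma),CWMS(\gamma)']\,dt,\qquad A_{WC(\gamma)}=\tfrac12\int_0^{T}[WC(\gamma),WC(\gamma)']\,dt$$ (the curve $WC(\gamma)$ has period $T$ and is traversed once). Then for every convex admissible curve $\gamma$: 1. $\displaystyle\frac{L_*(\gamma)^2}{4A_U}\ \ge\ A_\gamma-A_{CWMS(\gamma)}$, with equality if and only if $\gamma$ is symmetric. 2. $\displaystyle\frac{L_*(\gamma)^2}{4A_U}\ \ge\ A_\gamma-2A_{WC(\gamma)}$, with equality if and only if $\gamma$ has constant width. -/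

import Mathlib

open Set MeasureTheory
open scoped ContDiff

namespace NormedPlane

/-- The determinant `[a, b]` of the `2 × 2` matrix with columns `a` and `b`. -/
def det (a b : ℝ × ℝ) : ℝ := a.1 * b.2 - a.2 * b.1

/-- A smooth by parts, counterclockwise parameterization of the unit circle of the norm `N`
on the plane.  The parameter circle is `ℝ` modulo `2 * T`, and the break points `t i` cut it into
the `2 * n` arcs `[t i, t (i + 1)]`, `0 ≤ i < 2 * n` (indices are extended to `ℤ` periodically). -/
structure UnitCircle (N : Seminorm ℝ (ℝ × ℝ)) where
  /-- the parameterization of the unit circle -/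
  u : ℝ → ℝ × ℝ
  /-- half of the period -/
  T : ℝ
  /-- half of the number of arcs -/
  n : ℕ
  /-- the break points -/
  t : ℤ → ℝ
  T_pos : 0 < T
  t_zero : t 0 = 0
  t_strictMono : StrictMono t
  t_add : ∀ i, t (i + n) = t i + T
  u_add : ∀ s, u (s + T) = -u s
  injOn : InjOn u (Ico 0 (2 * T))
  range_eq : range u = {x | N x = 1}
  /-- each arc is smooth, end points included -/
  smooth : ∀ i, ContDiffOn ℝ ∞ u (Icc (t i) (t (i + 1)))
  /-- `u'` does not vanish on the closed arcs, and `u` runs counterclockwise -/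
  ccw : ∀ i, ∀ s ∈ Icc (t i) (t (i + 1)), 0 < det (u s) (derivWithin u (Icc (t i) (t (i + 1))) s)
  /-- each arc is a straight segment or is strictly convex with `[u', u''] ≠ 0` -/
  linear_or_curved : ∀ i,
    u '' Icc (t i) (t (i + 1)) = segment ℝ (u (t i)) (u (t (i + 1))) ∨
    ∀ s ∈ Icc (t i) (t (i + 1)),
      det (derivWithin u (Icc (t i) (t (i + 1))) s)
        (iteratedDerivWithin 2 u (Icc (t i) (t (i + 1))) s) ≠ 0
  /-- two consecutive straight segments meet in a genuine vertex -/
  vertex : ∀ i,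
    u '' Icc (t i) (t (i + 1)) = segment ℝ (u (t i)) (u (t (i + 1))) →
    u '' Icc (t (i + 1)) (t (i + 2)) = segment ℝ (u (t (i + 1))) (u (t (i + 2))) →
    det (u (t (i + 1)) - u (t i)) (u (t (i + 2)) - u (t (i + 1))) ≠ 0

/-- The area `A_U` of the unit ball `U` of the norm `N`. -/
noncomputable def unitBallArea (N : Seminorm ℝ (ℝ × ℝ)) : ℝ :=
  (volume (N.closedBall 0 1)).toReal

namespace UnitCircle

variable {N : Seminorm ℝ (ℝ × ℝ)} (P : UnitCircle N)

/-- The `i`-th arc of the unit circle is a straight segment. -/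
def IsLinearArc (i : ℤ) : Prop :=
  P.u '' Icc (P.t i) (P.t (i + 1)) = segment ℝ (P.u (P.t i)) (P.u (P.t (i + 1)))

/-- The point `v = u' / [u, u']` of the dual unit circle (used inside the arcs only). -/
noncomputable def v (s : ℝ) : ℝ × ℝ := (det (P.u s) (deriv P.u s))⁻¹ • deriv P.u s

end UnitCircle

/-- An admissible curve: a closed smooth by parts curve `γ` with `γ' = r u'` inside each arc,
where `r` is the curvature radius.  On an arc where `u` is a straight segment,
so is `γ`, and `r` is the ratio of the lengths of the two segments, hence constant. -/
structure AdmissibleCurve {N : Seminorm ℝ (ℝ × ℝ)} (P : UnitCircle N) where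
  /-- the curve -/
  γ : ℝ → ℝ × ℝ
  /-- the curvature radius (its values at the break points are irrelevant) -/
  r : ℝ → ℝ
  periodic : Function.Periodic γ (2 * P.T)
  smooth : ∀ i, ContDiffOn ℝ ∞ γ (Icc (P.t i) (P.t (i + 1)))
  deriv_eq : ∀ i, ∀ s ∈ Ioo (P.t i) (P.t (i + 1)), deriv γ s = r s • deriv P.u s
  linear_const : ∀ i, P.IsLinearArc i → ∃ c : ℝ, ∀ s ∈ Ioo (P.t i) (P.t (i + 1)), r s = c

/-- The signed area `1/2 ∫ [f, f']` of a closed curve `f` of period `p`, run through once. -/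
noncomputable def signedArea (p : ℝ) (f : ℝ → ℝ × ℝ) : ℝ :=
  (1 / 2) * ∫ s in (0 : ℝ)..p, det (f s) (deriv f s)

namespace AdmissibleCurve

variable {N : Seminorm ℝ (ℝ × ℝ)} {P : UnitCircle N} (c : AdmissibleCurve P)

/-- The curve is convex: it lies on the boundary of its convex hull. -/
def IsConvex : Prop := range c.γ ⊆ frontier (convexHull ℝ (range c.γ))

/-- The signed dual length `L_*(γ) = ∫ r [u, u']`. -/
noncomputable def dualLength : ℝ :=
  ∫ s in (0 : ℝ)..(2 * P.T), c.r s * det (P.u s) (deriv P.u s)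

/-- The mean width `w_γ = L_*(γ) / A_U`. -/
noncomputable def meanWidth : ℝ := c.dualLength / unitBallArea N

/-- The Wigner caustic of `γ`, a closed curve of period `T`. -/
noncomputable def wignerCaustic (s : ℝ) : ℝ × ℝ := (1 / 2 : ℝ) • (c.γ s + c.γ (s + P.T))

/-- The constant width measure set of `γ`, a closed curve of period `2 * T`. -/
noncomputable def cwms (s : ℝ) : ℝ × ℝ :=
  (1 / 2 : ℝ) • (c.γ s - c.γ (s + P.T) - c.meanWidth • P.u s)

/-- The signed area of `γ`. -/
noncomputable def area : ℝ := signedArea (2 * P.T) c.γ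

/-- The signed area of the Wigner caustic, which has period `T` and is run through once. -/
noncomputable def wignerCausticArea : ℝ := signedArea P.T c.wignerCaustic

/-- The signed area of the constant width measure set. -/
noncomputable def cwmsArea : ℝ := signedArea (2 * P.T) c.cwms

/-- The curve is symmetric with respect to some point `p`. -/
def IsSymmetric : Prop := ∃ p : ℝ × ℝ, ∀ s, c.γ (s + P.T) - p = -(c.γ s - p)

/-- The curve has constant width: `[γ, v](s + T) + [γ, v](s)` does not depend on `s`
(at a break point both one-sided values of `v` are covered, by continuity). -/
def HasConstantWidth : Prop :=
  ∃ w : ℝ, ∀ i, ∀ s ∈ Ioo (P.t i) (P.t (i + 1)),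
    det (c.γ (s + P.T)) (P.v (s + P.T)) + det (c.γ s) (P.v s) = w

end AdmissibleCurve

end NormedPlane

/-!
Split `γ` into its even part, the Wigner caustic `e = (γ(s) + γ(s + T)) / 2`, and its odd part
`o = (γ(s) - γ(s + T)) / 2`.  With `E = ∫₀ᵀ [e, e']`, `O = ∫₀ᵀ [o, o']`, `L₁ = ∫₀ᵀ [u, o']` and
`A_U = ∫₀ᵀ [u, u']` (`UnitCircle.unitBallArea_eq`), a computation gives `A_γ = E + O`,
`A_WC = E / 2`, `L_* = 2 L₁` and `A_CWMS = O - L₁² / A_U`.  So the two inequalities say `E ≤ 0`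
and `O ≤ L₁² / A_U`, the second being Minkowski's inequality for the mixed area of `o` and `u`.

Both follow from one fact (`UnitCircle.integral_det_nonpos`): if `m' = q u'` and the chord
`m(s₀ + T) - m(s₀)` is parallel to `u'(s₀)`, then the signed area `∫ [m - m(s₀), m']` over
`[s₀, s₀ + T]` is nonpositive.  In coordinates `X`, `Y` with `u'(s₀)` on the `Y`-axis, convexity
of the unit ball says that `X' = q a`, `Y' = q b` with `a ≥ 0` and `b / a` antitone, while `X`
vanishes at both ends; hence `∫ X dY = ∫ (b / a) d(X² / 2) = -∫ (X² / 2) d(b / a) ≥ 0`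
(`integral_mul_nonneg_of_antitone_slope`, proved by slicing along the levels of `b / a`).

The Wigner caustic has period `T`, so the fact applies to it directly.  For the odd part it is
applied to `o - λ u` with `λ = [o, v](s₀)`, which yields `O - 2 λ L₁ + λ² A_U ≤ 0`; completing the
square gives Minkowski's inequality, and equality forces `[o, v](s₀) = L₁ / A_U` for every `s₀`,
that is, constant width.  If `E = 0`, then `e` maximizes a nonpositive quadratic form, so its
variations along the arcs vanish, which says that `[e - p, u'] = 0` for some point `p`
(`AdmissibleCurve.exists_det_sub_eq_zero`); curvature, the vertex condition and the constancy of
`r` on straight arcs then give `e = p` (`UnitCircle.eq_zero_of_det_deriv_eq_zero`).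
-/

namespace NormedPlane

/-! ### Monotone slopes -/

lemma integral_ite_lt_eq_clamp {n τ : ℝ} (hn : 0 ≤ n) :
    ∫ s in (-n)..n, (if s < τ then (1 : ℝ) else 0) = n + max (-n) (min n τ) := by
  set c := max (-n) (min n τ) with hc
  have h1 : -n ≤ c := le_max_left _ _
  have h2 : c ≤ n := max_le (by linarith) (min_le_left _ _)
  have hmeas : Measurable (fun s : ℝ => if s < τ then (1 : ℝ) else 0) :=
    Measurable.ite measurableSet_Iio measurable_const measurable_const
  have hint : ∀ x y : ℝ, IntervalIntegrable (fun s : ℝ => if s < τ then (1 : ℝ) else 0)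
      volume x y := fun x y =>
    (intervalIntegrable_const (c := (1 : ℝ))).mono_fun hmeas.aestronglyMeasurable
      (Filter.Eventually.of_forall fun s => by dsimp; split_ifs <;> simp)
  rw [← intervalIntegral.integral_add_adjacent_intervals (hint (-n) c) (hint c n)]
  have e1 : ∫ s in (-n)..c, (if s < τ then (1 : ℝ) else 0) = ∫ s in (-n)..c, (1 : ℝ) := by
    refine intervalIntegral.integral_congr_ae ?_
    filter_upwards [Measure.ae_ne volume c] with s hs hsm
    rw [uIoc_of_le h1] at hsm
    have : s < c := lt_of_le_of_ne hsm.2 hs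
    rcases lt_max_iff.1 this with h | h
    · exact absurd hsm.1 (not_lt.2 h.le)
    · rw [if_pos (lt_of_lt_of_le h (min_le_right _ _))]
  have e2 : ∫ s in c..n, (if s < τ then (1 : ℝ) else 0) = ∫ s in c..n, (0 : ℝ) := by
    refine intervalIntegral.integral_congr_ae ?_
    filter_upwards with s hsm
    rw [uIoc_of_le h2] at hsm
    rw [if_neg]
    intro h
    have h3 : min n τ ≤ c := le_max_right _ _
    exact absurd hsm.1 (not_lt.2 ((le_min hsm.2 h.le).trans h3))
  rw [e1, e2]
  simp
  ring

section Core

variable {α β : ℝ} {C : Set ℝ} {a b q X : ℝ → ℝ}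

lemma integral_mul_deriv_eq_half_sq (hC : C.Countable)
    (hX : ContinuousOn X (Icc α β)) (hX' : ∀ t ∈ Ioo α β \ C, HasDerivAt X (q t * a t) t)
    (hXα : X α = 0) (hA : IntervalIntegrable (fun t => q t * a t) volume α β)
    {c : ℝ} (hc : c ∈ Icc α β) :
    ∫ t in α..c, X t * (q t * a t) = X c ^ 2 / 2 := by
  have hsub : Icc α c ⊆ Icc α β := Icc_subset_Icc_right hc.2
  have hA' : IntervalIntegrable (fun t => q t * a t) volume α c :=
    hA.mono_set (by rw [uIcc_of_le hc.1, uIcc_of_le (hc.1.trans hc.2)]; exact hsub)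
  rw [integral_eq_of_hasDerivAt_off_countable_of_le (fun t => X t ^ 2 / 2)
    (fun t => X t * (q t * a t)) hc.1 hC (((hX.mono hsub).pow 2).div_const 2)]
  · simp [hXα]
  · intro t ht
    have := ((hX' t ⟨⟨ht.1.1, ht.1.2.trans_le hc.2⟩, ht.2⟩).pow 2).div_const 2
    convert! this using 1
    norm_num
    ring
  · exact hA'.continuousOn_mul (by rw [uIcc_of_le hc.1]; exact hX.mono hsub)

/-- On a superlevel set of the slope `b / a` the integral of `X X'` is half of a square, since
this set is an initial interval up to points where `a` vanishes. -/
lemma integral_superlevel_nonneg (hαβ : α ≤ β) (hC : C.Countable)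
    (ha : ∀ t ∈ Ioo α β \ C, 0 ≤ a t)
    (hab : ∀ s ∈ Ioo α β \ C, ∀ t ∈ Ioo α β \ C, s < t → a s * b t ≤ b s * a t)
    (hX : ContinuousOn X (Icc α β)) (hX' : ∀ t ∈ Ioo α β \ C, HasDerivAt X (q t * a t) t)
    (hXα : X α = 0) (hA : IntervalIntegrable (fun t => q t * a t) volume α β) (σ : ℝ) :
    0 ≤ ∫ t in α..β, X t * (q t * a t) * (if σ * a t < b t then 1 else 0) := by
  set D : Set ℝ := insert α {t | t ∈ Ioo α β \ C ∧ 0 < a t ∧ σ * a t < b t} with hD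
  have hDsub : D ⊆ Icc α β := by
    rintro t (rfl | ht)
    · exact ⟨le_rfl, hαβ⟩
    · exact Ioo_subset_Icc_self ht.1.1
  have hDne : D.Nonempty := ⟨α, mem_insert _ _⟩
  have hDbdd : BddAbove D := ⟨β, fun t ht => (hDsub ht).2⟩
  set c := sSup D with hc
  have hcm : c ∈ Icc α β := ⟨le_csSup hDbdd (mem_insert _ _),
    csSup_le hDne fun t ht => (hDsub ht).2⟩
  have key : ∀ᵐ t : ℝ, t ∈ uIoc α β →
      X t * (q t * a t) * (if σ * a t < b t then 1 else 0) =
        (Iic c).indicator (fun t => X t * (q t * a t)) t := by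
    filter_upwards [Measure.ae_ne volume c, Measure.ae_ne volume β, hC.ae_notMem volume]
      with t htc htβ htC htm
    rw [uIoc_of_le hαβ] at htm
    have ht : t ∈ Ioo α β \ C := ⟨⟨htm.1, lt_of_le_of_ne htm.2 htβ⟩, htC⟩
    rcases (ha t ht).eq_or_lt with h0 | h0
    · simp only [indicator, ← h0]; simp
    rcases lt_or_gt_of_ne htc with h | h
    · rw [indicator_of_mem (show t ∈ Iic c from h.le), if_pos, mul_one]
      obtain ⟨t', ht', htt'⟩ := exists_lt_of_lt_csSup hDne h
      rcases ht' with rfl | ⟨h1, h2, h3⟩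
      · exact absurd htm.1 (not_lt.2 htt'.le)
      · have h4 := hab t ht t' h1 htt'
        by_contra h5
        push Not at h5
        have h6 : b t * a t' ≤ σ * a t * a t' := by gcongr
        have h7 : a t * (σ * a t') < a t * b t' := by gcongr
        nlinarith
    · rw [indicator_of_notMem (show t ∉ Iic c from not_le.2 h), if_neg, mul_zero]
      intro h5
      exact absurd (le_csSup hDbdd (mem_insert_of_mem _ ⟨ht, h0, h5⟩)) (not_le.2 h)
  rw [intervalIntegral.integral_congr_ae key, intervalIntegral.integral_of_le hαβ,
    setIntegral_indicator measurableSet_Iic]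
  have : Ioc α β ∩ Iic c = Ioc α c := by
    ext t; simp only [mem_inter_iff, mem_Ioc, mem_Iic]
    exact ⟨fun h => ⟨h.1.1, h.2⟩, fun h => ⟨⟨h.1, h.2.trans hcm.2⟩, h.2⟩⟩
  rw [this, ← intervalIntegral.integral_of_le hcm.1,
    integral_mul_deriv_eq_half_sq hC hX hX' hXα hA hcm]
  positivity

/-- The truncation of `b` at slope `± n` relative to `a ≥ 0`. -/
def slopeTruncation (a b : ℝ → ℝ) (n t : ℝ) : ℝ := max (-(n * a t)) (min (n * a t) (b t))

/-- Layer-cake formula for the truncation. -/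
lemma mul_integral_ite_eq_slopeTruncation {n t : ℝ} (hn : 0 ≤ n) (h : 0 ≤ a t) :
    a t * ((∫ s in (-n)..n, (if s * a t < b t then (1 : ℝ) else 0)) - n) =
      slopeTruncation a b n t := by
  unfold slopeTruncation
  rcases h.eq_or_lt with h0 | h0
  · rw [← h0]; rcases le_total (b t) 0 with hb | hb <;> simp [hb]
  · have : ∀ s, (s * a t < b t) = (s < b t / a t) := fun s => by rw [lt_div_iff₀ h0]
    simp_rw [this]
    rw [integral_ite_lt_eq_clamp hn, add_sub_cancel_left, mul_max_of_nonneg _ _ h0.le,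
      mul_min_of_nonneg _ _ h0.le, mul_div_cancel₀ _ h0.ne']
    congr 1
    · ring
    · rw [mul_comm]

lemma abs_slopeTruncation_le {n t : ℝ} (hn : 0 ≤ n) (h : 0 ≤ a t) :
    |slopeTruncation a b n t| ≤ |b t| := by
  unfold slopeTruncation
  have : 0 ≤ n * a t := mul_nonneg hn h
  rcases le_total 0 (b t) with hb | hb
  · rw [abs_of_nonneg hb, abs_of_nonneg (le_max_of_le_right (le_min this hb))]
    exact max_le (by linarith) (min_le_right _ _)
  · rw [abs_of_nonpos hb, abs_of_nonpos (max_le (by linarith) ((min_le_right _ _).trans hb)),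
      min_eq_right (hb.trans this)]
    linarith [le_max_right (-(n * a t)) (b t)]

/-- After truncation at slope `± n` the integral of `X q b` is, by Fubini, an integral over the
levels `σ ∈ (-n, n)` of the integrals of `X X'` over the superlevel sets of the slope. -/
lemma integral_slopeTruncation_nonneg (hαβ : α ≤ β) (hC : C.Countable)
    (ham : Measurable a) (hbm : Measurable b)
    (ha : ∀ t ∈ Ioo α β \ C, 0 ≤ a t)
    (hab : ∀ s ∈ Ioo α β \ C, ∀ t ∈ Ioo α β \ C, s < t → a s * b t ≤ b s * a t)
    (hX : ContinuousOn X (Icc α β)) (hX' : ∀ t ∈ Ioo α β \ C, HasDerivAt X (q t * a t) t)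
    (hXα : X α = 0) (hXβ : X β = 0)
    (hA : IntervalIntegrable (fun t => q t * a t) volume α β) {n : ℝ} (hn : 0 ≤ n) :
    AEStronglyMeasurable (fun t => X t * (q t * slopeTruncation a b n t))
      (volume.restrict (uIoc α β)) ∧
    0 ≤ ∫ t in α..β, X t * (q t * slopeTruncation a b n t) := by
  have hψ : IntervalIntegrable (fun t => X t * (q t * a t)) volume α β :=
    hA.continuousOn_mul (by rwa [uIcc_of_le hαβ])
  have hψ' : Integrable (fun t => X t * (q t * a t)) (volume.restrict (uIoc α β)) :=
    hψ.def'
  have : IsFiniteMeasure (volume.restrict (uIoc (-n) n)) := by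
    rw [uIoc_of_le (by linarith)]; infer_instance
  have hprod : Integrable (Function.uncurry fun s t : ℝ =>
      X t * (q t * a t) * (if s * a t < b t then (1 : ℝ) else 0))
      ((volume.restrict (uIoc (-n) n)).prod (volume.restrict (uIoc α β))) := by
    have h1 := Integrable.mul_prod (μ := volume.restrict (uIoc (-n) n))
      (ν := volume.restrict (uIoc α β)) (f := fun _ => (1 : ℝ))
      (integrable_const (1 : ℝ)) hψ'
    have hset : MeasurableSet {z : ℝ × ℝ | z.1 * a z.2 < b z.2} :=
      measurableSet_lt (measurable_fst.mul (ham.comp measurable_snd)) (hbm.comp measurable_snd)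
    have h2 : Measurable fun z : ℝ × ℝ => if z.1 * a z.2 < b z.2 then (1 : ℝ) else 0 :=
      Measurable.ite hset measurable_const measurable_const
    have h3 := h1.mul_bdd (c := 1) h2.aestronglyMeasurable
      (Filter.Eventually.of_forall fun z => by split_ifs <;> simp)
    refine h3.congr (Filter.Eventually.of_forall fun z => ?_)
    simp [Function.uncurry]
  have hswap := intervalIntegral_integral_swap hprod
  have hJ : Integrable (fun t => ∫ s in (-n)..n,
      X t * (q t * a t) * (if s * a t < b t then (1 : ℝ) else 0))
      (volume.restrict (uIoc α β)) := by
    have := hprod.integral_prod_right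
    refine this.congr (Filter.Eventually.of_forall fun t => ?_)
    dsimp only
    rw [intervalIntegral.integral_of_le (by linarith), uIoc_of_le (by linarith : -n ≤ n)]
    rfl
  have hpt : ∀ᵐ t ∂(volume.restrict (uIoc α β)),
      (∫ s in (-n)..n, X t * (q t * a t) * (if s * a t < b t then (1 : ℝ) else 0))
        - n * (X t * (q t * a t)) = X t * (q t * slopeTruncation a b n t) := by
    rw [ae_restrict_iff' measurableSet_uIoc]
    filter_upwards [Measure.ae_ne volume β, hC.ae_notMem volume] with t htβ htC htm
    rw [uIoc_of_le hαβ] at htm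
    have ht : t ∈ Ioo α β \ C := ⟨⟨htm.1, lt_of_le_of_ne htm.2 htβ⟩, htC⟩
    rw [← mul_integral_ite_eq_slopeTruncation hn (ha t ht), intervalIntegral.integral_const_mul]
    ring
  have hint := hJ.sub (hψ'.const_mul n)
  refine ⟨(hint.congr hpt).aestronglyMeasurable, ?_⟩
  have e1 : ∫ t in α..β, X t * (q t * slopeTruncation a b n t) =
      ∫ t in uIoc α β, ((∫ s in (-n)..n, X t * (q t * a t) * (if s * a t < b t then (1 : ℝ) else 0))
        - n * (X t * (q t * a t))) := by
    rw [intervalIntegral.integral_of_le hαβ, ← uIoc_of_le hαβ]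
    exact (integral_congr_ae hpt).symm
  rw [e1, integral_sub hJ (hψ'.const_mul n), ← hswap, integral_const_mul, uIoc_of_le hαβ,
    ← intervalIntegral.integral_of_le hαβ,
    integral_mul_deriv_eq_half_sq hC hX hX' hXα hA ⟨hαβ, le_rfl⟩, hXβ]
  norm_num
  refine intervalIntegral.integral_nonneg (by linarith) fun s _ => ?_
  have := integral_superlevel_nonneg hαβ hC ha hab hX hX' hXα hA s
  rw [intervalIntegral.integral_of_le hαβ] at this
  simpa using this

/-- Let the vectors `(a, b)` have `a ≥ 0` and turn clockwise, so that the slope `b / a` is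
antitone, and let the plane curve `(X, Y)` have velocity `q (a, b)`, with `X` vanishing at both
ends.  Then `∫ X Y' ≥ 0`.  Formally `∫ X Y' = ∫ (b / a) d(X² / 2) = -∫ (X² / 2) d(b / a)`; no
regularity of the slope is needed, and it may be infinite near the ends of the interval. -/
theorem integral_mul_nonneg_of_antitone_slope (hαβ : α ≤ β) (hC : C.Countable)
    (ham : Measurable a) (hbm : Measurable b)
    (ha : ∀ t ∈ Ioo α β \ C, 0 ≤ a t)
    (hab : ∀ s ∈ Ioo α β \ C, ∀ t ∈ Ioo α β \ C, s < t → a s * b t ≤ b s * a t)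
    (hX : ContinuousOn X (Icc α β)) (hX' : ∀ t ∈ Ioo α β \ C, HasDerivAt X (q t * a t) t)
    (hXα : X α = 0) (hXβ : X β = 0)
    (hA : IntervalIntegrable (fun t => q t * a t) volume α β)
    (hB : IntervalIntegrable (fun t => q t * b t) volume α β) :
    0 ≤ ∫ t in α..β, X t * (q t * b t) := by
  have hbound : IntervalIntegrable (fun t => |X t * (q t * b t)|) volume α β :=
    (hB.continuousOn_mul (by rwa [uIcc_of_le hαβ])).abs
  have hzero : ∀ x ∈ Icc α β, ∀ y ∈ Icc α β, x ≤ y → (∀ t ∈ Ioo x y \ C, a t = 0) →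
      X y = X x := by
    intro x hx y hy hxy h
    have hsub : Icc x y ⊆ Icc α β := Icc_subset_Icc hx.1 hy.2
    have := integral_eq_of_hasDerivAt_off_countable_of_le X (fun _ => 0) hxy hC (hX.mono hsub)
      (fun t ht => by
        have := hX' t ⟨⟨hx.1.trans_lt ht.1.1, ht.1.2.trans_le hy.2⟩, ht.2⟩
        rwa [h t ht, mul_zero] at this) intervalIntegrable_const
    simp at this
    linarith
  -- dominated convergence as the truncation level tends to infinity
  have hlim := intervalIntegral.tendsto_integral_filter_of_dominated_convergence
    (μ := volume) (a := α) (b := β) (l := Filter.atTop)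
    (F := fun (n : ℕ) t => X t * (q t * slopeTruncation a b n t))
    (f := fun t => X t * (q t * b t)) (fun t => |X t * (q t * b t)|)
    (Filter.Eventually.of_forall fun n =>
      (integral_slopeTruncation_nonneg hαβ hC ham hbm ha hab hX hX' hXα hXβ hA n.cast_nonneg).1)
    (Filter.Eventually.of_forall fun n => by
      filter_upwards [Measure.ae_ne volume β, hC.ae_notMem volume] with t htβ htC htm
      rw [uIoc_of_le hαβ] at htm
      have ht : t ∈ Ioo α β \ C := ⟨⟨htm.1, lt_of_le_of_ne htm.2 htβ⟩, htC⟩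
      rw [Real.norm_eq_abs, abs_mul, abs_mul, abs_mul, abs_mul]
      refine mul_le_mul_of_nonneg_left (mul_le_mul_of_nonneg_left ?_ (abs_nonneg _)) (abs_nonneg _)
      exact abs_slopeTruncation_le n.cast_nonneg (ha t ht))
    hbound
    (by
      filter_upwards [Measure.ae_ne volume β, hC.ae_notMem volume] with t htβ htC htm
      rw [uIoc_of_le hαβ] at htm
      have ht : t ∈ Ioo α β \ C := ⟨⟨htm.1, lt_of_le_of_ne htm.2 htβ⟩, htC⟩
      rcases (ha t ht).eq_or_lt with h0 | h0
      · -- where `a` vanishes, it vanishes all the way to one of the end points, hence so does `X`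
        have hz : X t * (q t * b t) = 0 := by
          rcases lt_trichotomy (b t) 0 with hb | hb | hb
          · have : X β = X t := hzero t (Ioo_subset_Icc_self ht.1) β ⟨hαβ, le_rfl⟩ htm.2 (by
              intro s hs
              have hs' : s ∈ Ioo α β \ C := ⟨⟨htm.1.trans hs.1.1, hs.1.2⟩, hs.2⟩
              have h1 := hab t ht s hs' hs.1.1
              have h2 := ha s hs'
              rw [← h0] at h1
              nlinarith)
            rw [← this, hXβ, zero_mul]
          · rw [hb]; ring
          · have : X t = X α := hzero α ⟨le_rfl, hαβ⟩ t (Ioo_subset_Icc_self ht.1) htm.1.le (by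
              intro s hs
              have hs' : s ∈ Ioo α β \ C := ⟨⟨hs.1.1, hs.1.2.trans ht.1.2⟩, hs.2⟩
              have h1 := hab s hs' t ht hs.1.2
              have h2 := ha s hs'
              rw [← h0] at h1
              nlinarith)
            rw [this, hXα, zero_mul]
        rw [hz]
        refine tendsto_const_nhds.congr fun n => ?_
        simp only [slopeTruncation, ← h0, mul_zero, neg_zero]
        rcases le_total (b t) 0 with hb | hb <;> simp [hb]
      · obtain ⟨k, hk⟩ := exists_nat_ge (|b t| / a t)
        refine tendsto_const_nhds.congr' ?_
        filter_upwards [Filter.eventually_ge_atTop k] with n hn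
        have h1 : |b t| ≤ n * a t := by
          rw [div_le_iff₀ h0] at hk
          refine hk.trans ?_
          gcongr
        rw [abs_le] at h1
        rw [slopeTruncation, min_eq_right h1.2, max_eq_right h1.1])
  exact ge_of_tendsto' hlim fun n =>
    (integral_slopeTruncation_nonneg hαβ hC ham hbm ha hab hX hX' hXα hXβ hA n.cast_nonneg).2

end Core

/-! ### The determinant -/

lemma det_add_left (a b c : ℝ × ℝ) : det (a + b) c = det a c + det b c := by simp [det]; ring
lemma det_add_right (a b c : ℝ × ℝ) : det a (b + c) = det a b + det a c := by simp [det]; ring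
lemma det_sub_left (a b c : ℝ × ℝ) : det (a - b) c = det a c - det b c := by simp [det]; ring
lemma det_sub_right (a b c : ℝ × ℝ) : det a (b - c) = det a b - det a c := by simp [det]; ring
lemma det_smul_left (k : ℝ) (a b : ℝ × ℝ) : det (k • a) b = k * det a b := by simp [det]; ring
lemma det_smul_right (k : ℝ) (a b : ℝ × ℝ) : det a (k • b) = k * det a b := by simp [det]; ring
lemma det_neg_left (a b : ℝ × ℝ) : det (-a) b = -det a b := by simp [det]; ring
lemma det_neg_right (a b : ℝ × ℝ) : det a (-b) = -det a b := by simp [det]; ring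
lemma det_zero_left (a : ℝ × ℝ) : det 0 a = 0 := by simp [det]
lemma det_self (a : ℝ × ℝ) : det a a = 0 := by simp [det]; ring
lemma det_comm (a b : ℝ × ℝ) : det a b = -det b a := by simp [det]; ring

lemma eq_zero_of_det_eq_zero {x a b : ℝ × ℝ} (hab : det a b ≠ 0) (ha : det x a = 0)
    (hb : det x b = 0) : x = 0 := by
  simp only [det] at *
  ext
  · have : x.1 * (a.1 * b.2 - a.2 * b.1) = 0 := by linear_combination a.1 * hb - b.1 * ha
    simpa [hab] using this
  · have : x.2 * (a.1 * b.2 - a.2 * b.1) = 0 := by linear_combination a.2 * hb - b.2 * ha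
    simpa [hab] using this

lemma continuous_det : Continuous fun z : (ℝ × ℝ) × (ℝ × ℝ) => det z.1 z.2 := by
  unfold det; fun_prop

lemma measurable_det : Measurable fun z : (ℝ × ℝ) × (ℝ × ℝ) => det z.1 z.2 :=
  continuous_det.measurable

lemma abs_det_le (a b : ℝ × ℝ) : |det a b| ≤ 2 * (‖a‖ * ‖b‖) := by
  have h1 := norm_fst_le a
  have h2 := norm_snd_le a
  have h3 := norm_fst_le b
  have h4 := norm_snd_le b
  rw [Real.norm_eq_abs] at h1 h2 h3 h4
  calc |det a b| ≤ |a.1 * b.2| + |a.2 * b.1| := abs_sub _ _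
    _ = |a.1| * |b.2| + |a.2| * |b.1| := by rw [abs_mul, abs_mul]
    _ ≤ ‖a‖ * ‖b‖ + ‖a‖ * ‖b‖ := by gcongr
    _ = _ := by ring

lemma _root_.HasDerivAt.det {f g : ℝ → ℝ × ℝ} {f' g' : ℝ × ℝ} {s : ℝ} (hf : HasDerivAt f f' s)
    (hg : HasDerivAt g g' s) :
    HasDerivAt (fun s => det (f s) (g s)) (det f' (g s) + det (f s) g') s := by
  have f1 : HasDerivAt (fun s => (f s).1) f'.1 s := by
    exact hasFDerivAt_fst.comp_hasDerivAt s hf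
  have f2 : HasDerivAt (fun s => (f s).2) f'.2 s := by
    exact hasFDerivAt_snd.comp_hasDerivAt s hf
  have g1 : HasDerivAt (fun s => (g s).1) g'.1 s := by
    exact hasFDerivAt_fst.comp_hasDerivAt s hg
  have g2 : HasDerivAt (fun s => (g s).2) g'.2 s := by
    exact hasFDerivAt_snd.comp_hasDerivAt s hg
  convert! (f1.mul g2).sub (f2.mul g1) using 1
  simp only [NormedPlane.det]
  ring

/-! ### Antiperiodic curves -/

lemma periodic_two_mul {f : ℝ → ℝ × ℝ} {T : ℝ} (h : ∀ s, f (s + T) = -f s) :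
    Function.Periodic f (2 * T) := fun s => by rw [two_mul, ← add_assoc, h, h, neg_neg]

lemma deriv_add_of_odd {f : ℝ → ℝ × ℝ} {T : ℝ} (h : ∀ s, f (s + T) = -f s) (s : ℝ) :
    deriv f (s + T) = -deriv f s := by
  rw [← deriv_comp_add_const, ← deriv.fun_neg]
  congr 1
  exact funext h

lemma periodic_det_deriv_of_odd {f : ℝ → ℝ × ℝ} {T : ℝ} (h : ∀ s, f (s + T) = -f s) :
    Function.Periodic (fun s => det (f s) (deriv f s)) T := fun s => by
  simp only [h, deriv_add_of_odd h, det_neg_left, det_neg_right, neg_neg]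

lemma integral_two_mul_of_periodic {g : ℝ → ℝ} {T : ℝ} (hg : Function.Periodic g T) (hT : 0 < T)
    (hint : IntervalIntegrable g volume 0 T) :
    ∫ s in (0 : ℝ)..(2 * T), g s = 2 * ∫ s in (0 : ℝ)..T, g s := by
  have h := hg.intervalIntegral_add_zsmul_eq 2 0 (hg.intervalIntegrable₀ hT.ne' hint)
  simpa using h

lemma integral_zero_two_mul {g : ℝ → ℝ} {T : ℝ} (hg : ∀ a b, IntervalIntegrable g volume a b) :
    ∫ s in (0 : ℝ)..2 * T, g s = ∫ s in (0 : ℝ)..T, (g s + g (s + T)) := by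
  have h := intervalIntegral.integral_comp_add_right (a := 0) (b := T) g T
  have hi : IntervalIntegrable (fun s => g (s + T)) volume 0 T :=
    (IntervalIntegrable.comp_add_right_iff (by simp)).2 (hg _ _)
  rw [intervalIntegral.integral_add (hg _ _) hi, h, zero_add, ← two_mul,
    intervalIntegral.integral_add_adjacent_intervals (hg _ _) (hg _ _)]

/-! ### The subdivision into arcs and arcwise smooth curves -/

namespace UnitCircle

variable {N : Seminorm ℝ (ℝ × ℝ)} (P : UnitCircle N)

lemma n_pos : 0 < P.n := by
  rcases Nat.eq_zero_or_pos P.n with h | h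
  · have h1 := P.t_add 0
    have h2 := P.T_pos
    simp only [h, Nat.cast_zero, add_zero] at h1
    linarith
  · exact h

lemma t_add_mul (i k : ℤ) : P.t (i + k * P.n) = P.t i + k * P.T := by
  induction k using Int.induction_on with
  | zero => simp
  | succ k ih =>
    rw [show i + ((k : ℤ) + 1) * (P.n : ℤ) = i + k * P.n + P.n by ring, P.t_add, ih]
    push_cast; ring
  | pred k ih =>
    have := P.t_add (i + (-(k : ℤ) - 1) * P.n)
    rw [show i + (-(k : ℤ) - 1) * (P.n : ℤ) + P.n = i + -k * P.n by ring, ih] at this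
    push_cast at this ⊢
    linarith

lemma exists_mem_Ico (s : ℝ) : ∃ i, s ∈ Ico (P.t i) (P.t (i + 1)) := by
  have hT := P.T_pos
  obtain ⟨k, hk⟩ := exists_int_gt (s / P.T)
  obtain ⟨l, hl⟩ := exists_int_lt (s / P.T)
  rw [div_lt_iff₀ hT] at hk
  rw [lt_div_iff₀ hT] at hl
  have tk := P.t_add_mul 0 k
  have tl := P.t_add_mul 0 l
  rw [P.t_zero, zero_add, zero_add] at tk tl
  obtain ⟨i, hi, hmax⟩ := Int.exists_greatest_of_bdd (P := fun i => P.t i ≤ s)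
    ⟨k * P.n, fun z hz => P.t_strictMono.le_iff_le.1 (by rw [tk]; linarith)⟩
    ⟨l * P.n, by rw [tl]; exact hl.le⟩
  refine ⟨i, hi, ?_⟩
  by_contra h
  have := hmax (i + 1) (not_lt.1 h)
  omega

lemma exists_mem_Ioo {s : ℝ} (hs : s ∉ range P.t) : ∃ i, s ∈ Ioo (P.t i) (P.t (i + 1)) := by
  obtain ⟨i, hi⟩ := P.exists_mem_Ico s
  exact ⟨i, lt_of_le_of_ne hi.1 fun h => hs ⟨i, h⟩, hi.2⟩

lemma t_lt (i : ℤ) : P.t i < P.t (i + 1) := P.t_strictMono (by omega)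

lemma notMem_range_of_mem_Ioo {i : ℤ} {s : ℝ} (hs : s ∈ Ioo (P.t i) (P.t (i + 1))) :
    s ∉ range P.t := by
  rintro ⟨j, rfl⟩
  have h1 := P.t_strictMono.lt_iff_lt.1 hs.1
  have h2 := P.t_strictMono.lt_iff_lt.1 hs.2
  omega

lemma add_T_mem_range_iff {s : ℝ} : s + P.T ∈ range P.t ↔ s ∈ range P.t := by
  constructor
  · rintro ⟨j, hj⟩
    refine ⟨j - P.n, ?_⟩
    have := P.t_add (j - P.n)
    rw [sub_add_cancel, hj] at this
    linarith
  · rintro ⟨j, rfl⟩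
    exact ⟨j + P.n, P.t_add j⟩

lemma countable_range_t : (range P.t).Countable := countable_range _

lemma ae_notMem_range_t : ∀ᵐ s : ℝ, s ∉ range P.t := P.countable_range_t.ae_notMem volume

/-- A curve that is smooth on each closed arc of the subdivision. -/
def ArcwiseSmooth (f : ℝ → ℝ × ℝ) : Prop :=
  ∀ i, ContDiffOn ℝ ∞ f (Icc (P.t i) (P.t (i + 1)))

namespace ArcwiseSmooth

variable {P} {f g : ℝ → ℝ × ℝ}

lemma add (hf : P.ArcwiseSmooth f) (hg : P.ArcwiseSmooth g) :
    P.ArcwiseSmooth fun s => f s + g s := fun i => (hf i).add (hg i)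

lemma sub (hf : P.ArcwiseSmooth f) (hg : P.ArcwiseSmooth g) :
    P.ArcwiseSmooth fun s => f s - g s := fun i => (hf i).sub (hg i)

lemma const_smul (k : ℝ) (hf : P.ArcwiseSmooth f) : P.ArcwiseSmooth fun s => k • f s :=
  fun i => (contDiffOn_const (c := k)).fun_smul (hf i)

lemma comp_add_T (hf : P.ArcwiseSmooth f) : P.ArcwiseSmooth fun s => f (s + P.T) := by
  intro i
  have h := hf (i + P.n)
  refine h.comp (contDiff_id.add contDiff_const).contDiffOn fun s hs => ?_
  rw [P.t_add, show i + (P.n : ℤ) + 1 = i + 1 + P.n by ring, P.t_add]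
  exact ⟨by simpa using hs.1, by simpa using hs.2⟩

lemma continuous (hf : P.ArcwiseSmooth f) : Continuous f := by
  refine continuous_iff_continuousAt.2 fun s => ?_
  obtain ⟨i, hi⟩ := P.exists_mem_Ico s
  rcases hi.1.eq_or_lt with h | h
  · have h1 := (hf (i - 1)).continuousOn
    have h2 := (hf i).continuousOn
    rw [sub_add_cancel] at h1
    have hlt := P.t_lt (i - 1)
    rw [sub_add_cancel] at hlt
    have c1 := h1 s ⟨by linarith, h.ge⟩
    have c2 := h2 s ⟨hi.1, hi.2.le⟩
    refine (c1.union c2).continuousAt ?_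
    refine Filter.mem_of_superset (Icc_mem_nhds (h ▸ hlt) hi.2) ?_
    rw [Icc_union_Icc_eq_Icc hlt.le (P.t_lt i).le]
  · exact (hf i).continuousOn.continuousAt (Icc_mem_nhds h hi.2)

lemma contDiffOn_Ioo (hf : P.ArcwiseSmooth f) (i : ℤ) :
    ContDiffOn ℝ ∞ f (Ioo (P.t i) (P.t (i + 1))) := (hf i).mono Ioo_subset_Icc_self

lemma contDiffOn_deriv (hf : P.ArcwiseSmooth f) (i : ℤ) :
    ContDiffOn ℝ ∞ (deriv f) (Ioo (P.t i) (P.t (i + 1))) :=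
  (hf.contDiffOn_Ioo i).deriv_of_isOpen isOpen_Ioo (by simp)

lemma hasDerivAt (hf : P.ArcwiseSmooth f) {s : ℝ} (hs : s ∉ range P.t) :
    HasDerivAt f (deriv f s) s := by
  obtain ⟨i, hi⟩ := P.exists_mem_Ioo hs
  exact (((hf.contDiffOn_Ioo i).contDiffAt (isOpen_Ioo.mem_nhds hi)).differentiableAt
    (by simp)).hasDerivAt

lemma hasDerivAt_deriv (hf : P.ArcwiseSmooth f) {s : ℝ} (hs : s ∉ range P.t) :
    HasDerivAt (deriv f) (deriv (deriv f) s) s := by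
  obtain ⟨i, hi⟩ := P.exists_mem_Ioo hs
  exact (((hf.contDiffOn_deriv i).contDiffAt (isOpen_Ioo.mem_nhds hi)).differentiableAt
    (by simp)).hasDerivAt

lemma derivWithin_eq {i : ℤ} {s : ℝ} (hs : s ∈ Ioo (P.t i) (P.t (i + 1))) :
    derivWithin f (Icc (P.t i) (P.t (i + 1))) s = deriv f s :=
  derivWithin_of_mem_nhds (Icc_mem_nhds hs.1 hs.2)

end ArcwiseSmooth

lemma arcwiseSmooth_u : P.ArcwiseSmooth P.u := P.smooth

lemma _root_.Function.Periodic.deriv' {f : ℝ → ℝ × ℝ} {c : ℝ} (h : Function.Periodic f c) :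
    Function.Periodic (deriv f) c := by
  intro s
  rw [← deriv_comp_add_const]
  congr 1
  exact funext h

/-- The bound is the sum of the bounds on the closed arcs in one period. -/
lemma ArcwiseSmooth.bounded_deriv {f : ℝ → ℝ × ℝ} (hf : P.ArcwiseSmooth f)
    (hper : Function.Periodic f (2 * P.T)) :
    ∃ M, 0 ≤ M ∧ ∀ s ∉ range P.t, ‖deriv f s‖ ≤ M := by
  have h1 : ∀ i, ∃ M, ∀ s ∈ Icc (P.t i) (P.t (i + 1)),
      ‖derivWithin f (Icc (P.t i) (P.t (i + 1))) s‖ ≤ M := fun i =>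
    isCompact_Icc.exists_bound_of_continuousOn
      ((hf i).continuousOn_derivWithin (uniqueDiffOn_Icc (P.t_lt i)) (by simp))
  choose M hM using h1
  have hn : (0 : ℤ) < 2 * P.n := by have := P.n_pos; omega
  refine ⟨∑ j ∈ Finset.range (2 * P.n), |M j|, Finset.sum_nonneg fun _ _ => abs_nonneg _, ?_⟩
  intro s hs
  obtain ⟨i, hi⟩ := P.exists_mem_Ioo hs
  set j := i % (2 * P.n) with hj
  set k := i / (2 * P.n) with hk
  have hij : i = j + (2 * k) * P.n := by
    have := Int.emod_add_mul_ediv i (2 * P.n)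
    rw [← hj, ← hk] at this
    linear_combination -this
  have hj0 : 0 ≤ j := Int.emod_nonneg _ hn.ne'
  have hj1 : j < 2 * P.n := Int.emod_lt_of_pos _ hn
  have e1 := P.t_add_mul j (2 * k)
  have e2 := P.t_add_mul (j + 1) (2 * k)
  rw [← hij] at e1
  rw [show j + 1 + 2 * k * (P.n : ℤ) = i + 1 by rw [hij]; ring] at e2
  push_cast at e1 e2
  have hmem : s - k * (2 * P.T) ∈ Ioo (P.t j) (P.t (j + 1)) := by
    rw [e1, e2] at hi
    exact ⟨by linarith [hi.1], by linarith [hi.2]⟩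
  have h2 := hM j _ (Ioo_subset_Icc_self hmem)
  rw [derivWithin_eq hmem, hper.deriv'.sub_int_mul_eq k] at h2
  obtain ⟨m, hm⟩ := Int.eq_ofNat_of_zero_le hj0
  rw [hm] at h2
  refine h2.trans ((le_abs_self _).trans ?_)
  exact Finset.single_le_sum (f := fun j : ℕ => |M j|) (fun _ _ => abs_nonneg _)
    (Finset.mem_range.2 (by omega))

lemma ArcwiseSmooth.intervalIntegrable_det {f g : ℝ → ℝ × ℝ} (hf : P.ArcwiseSmooth f)
    (hper : Function.Periodic f (2 * P.T)) (hg : Continuous g) (a b : ℝ) :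
    IntervalIntegrable (fun s => det (g s) (deriv f s)) volume a b := by
  obtain ⟨M, hM0, hM⟩ := hf.bounded_deriv P hper
  have h1 : IntervalIntegrable (fun s => ‖g s‖ * (2 * M)) volume a b :=
    (hg.norm.mul continuous_const).intervalIntegrable _ _
  refine h1.mono_fun (measurable_det.comp
    (hg.measurable.prodMk (measurable_deriv f))).aestronglyMeasurable ?_
  filter_upwards [ae_restrict_of_ae P.ae_notMem_range_t] with s hs
  refine (abs_det_le _ _).trans (le_trans ?_ (le_abs_self _))
  have := mul_le_mul_of_nonneg_left (hM s hs) (norm_nonneg (g s))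
  linarith

/-- Fundamental theorem of calculus for continuous functions, differentiable off break points. -/
lemma integral_eq_sub_of_hasDerivAt {E : Type*} [NormedAddCommGroup E] [NormedSpace ℝ E]
    [CompleteSpace E] {f f' : ℝ → E} (hf : Continuous f)
    (hf' : ∀ s ∉ range P.t, HasDerivAt f (f' s) s) {a b : ℝ}
    (hint : IntervalIntegrable f' volume a b) :
    ∫ s in a..b, f' s = f b - f a :=
  integral_eq_of_hasDerivAt_off_countable f f' P.countable_range_t hf.continuousOn
    (fun s hs => hf' s hs.2) hint

/-! ### Convexity of the unit circle -/

lemma periodic_u : Function.Periodic P.u (2 * P.T) := periodic_two_mul P.u_add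

lemma continuous_u : Continuous P.u := P.arcwiseSmooth_u.continuous

lemma hasDerivAt_u {s : ℝ} (hs : s ∉ range P.t) : HasDerivAt P.u (deriv P.u s) s :=
  P.arcwiseSmooth_u.hasDerivAt hs

lemma deriv_u_add (s : ℝ) : deriv P.u (s + P.T) = -deriv P.u s := deriv_add_of_odd P.u_add s

lemma N_u (s : ℝ) : N (P.u s) = 1 := by
  have : P.u s ∈ range P.u := ⟨s, rfl⟩
  rwa [P.range_eq] at this

lemma u_ne_zero (s : ℝ) : P.u s ≠ 0 := fun h => by
  have := P.N_u s
  rw [h, map_zero] at this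
  exact zero_ne_one this

lemma det_u_deriv_pos {s : ℝ} (hs : s ∉ range P.t) : 0 < det (P.u s) (deriv P.u s) := by
  obtain ⟨i, hi⟩ := P.exists_mem_Ioo hs
  have := P.ccw i s (Ioo_subset_Icc_self hi)
  rwa [ArcwiseSmooth.derivWithin_eq hi] at this

lemma eq_of_u_eq {x y : ℝ} (h : P.u x = P.u y) (hxy : |x - y| < 2 * P.T) : x = y := by
  have hT : 0 < 2 * P.T := by linarith [P.T_pos]
  have key : ∀ z : ℝ, ∃ k : ℤ, z - k * (2 * P.T) ∈ Ico 0 (2 * P.T) := fun z => by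
    refine ⟨⌊z / (2 * P.T)⌋, ?_, ?_⟩
    · have := Int.floor_le (z / (2 * P.T))
      rw [le_div_iff₀ hT] at this
      linarith
    · have := Int.lt_floor_add_one (z / (2 * P.T))
      rw [div_lt_iff₀ hT] at this
      linarith
  obtain ⟨k, hk⟩ := key x
  obtain ⟨l, hl⟩ := key y
  have h1 : x - k * (2 * P.T) = y - l * (2 * P.T) := P.injOn hk hl (by
    rw [P.periodic_u.sub_int_mul_eq, P.periodic_u.sub_int_mul_eq, h])
  have h2 : x - y = ((k - l : ℤ) : ℝ) * (2 * P.T) := by push_cast; linarith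
  rw [h2, abs_mul, abs_of_pos hT, mul_lt_iff_lt_one_left hT] at hxy
  have h3 : k - l = 0 := by
    rw [← Int.abs_lt_one_iff]; exact_mod_cast hxy
  rw [h3] at h2
  simp at h2
  linarith

/-- `[u(s), ·]` is positive on the half circle after `u(s)`: it is so right after `s`, and its
only zeros on the unit circle are `± u(s)`. -/
lemma det_u_u_pos {s t : ℝ} (hs : s ∉ range P.t) (hst : s < t) (ht : t < s + P.T) :
    0 < det (P.u s) (P.u t) := by
  have hT := P.T_pos
  have hne : ∀ r ∈ Ioo s (s + P.T), det (P.u s) (P.u r) ≠ 0 := by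
    intro r hr h0
    have hp := P.det_u_deriv_pos hs
    -- `u r` is a multiple of `u s`
    obtain ⟨k, hk⟩ : ∃ k : ℝ, P.u r = k • P.u s := by
      refine ⟨det (P.u r) (deriv P.u s) / det (P.u s) (deriv P.u s), ?_⟩
      rw [← sub_eq_zero]
      refine eq_zero_of_det_eq_zero hp.ne' ?_ ?_
      · rw [det_sub_left, det_smul_left, det_self, det_comm, h0]; ring
      · rw [det_sub_left, det_smul_left, div_mul_cancel₀ _ hp.ne', sub_self]
    have h1 := P.N_u r
    rw [hk, map_smul_eq_mul, P.N_u, mul_one, Real.norm_eq_abs, abs_eq zero_le_one] at h1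
    rcases h1 with h1 | h1
    · rw [h1, one_smul] at hk
      have := P.eq_of_u_eq hk (by rw [abs_lt]; constructor <;> linarith [hr.1, hr.2])
      exact hr.1.ne' this
    · rw [h1, neg_smul, one_smul, ← P.u_add] at hk
      have := P.eq_of_u_eq hk (by rw [abs_lt]; constructor <;> linarith [hr.1, hr.2])
      exact hr.2.ne this
  have hg : HasDerivAt (fun r => det (P.u s) (P.u r)) (det (P.u s) (deriv P.u s)) s := by
    have := (hasDerivAt_const s (P.u s)).det (P.hasDerivAt_u hs)
    simpa [det_zero_left] using this
  have hcont : Continuous fun r => det (P.u s) (P.u r) :=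
    continuous_det.comp (continuous_const.prodMk P.continuous_u)
  by_contra hneg
  push Not at hneg
  have hev : ∀ᶠ r in nhdsWithin s (Ioi s), 0 < slope (fun r => det (P.u s) (P.u r)) s r := by
    have := (hasDerivAt_iff_tendsto_slope.1 hg).mono_left
      (nhdsWithin_mono s (fun r (hr : r ∈ Ioi s) => (ne_of_gt hr : r ∈ ({s} : Set ℝ)ᶜ)))
    exact this.eventually (lt_mem_nhds (P.det_u_deriv_pos hs))
  obtain ⟨r, hr, hrm⟩ := (hev.and (Ioo_mem_nhdsGT hst)).exists
  have hr' : 0 < det (P.u s) (P.u r) := by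
    rw [slope_def_field, det_self, sub_zero] at hr
    exact (div_pos_iff_of_pos_right (sub_pos.2 hrm.1)).1 hr
  obtain ⟨z, hz, hz0⟩ := intermediate_value_Icc' hrm.2.le hcont.continuousOn ⟨hneg, hr'.le⟩
  exact hne z ⟨hrm.1.trans_le hz.1, hz.2.trans_lt ht⟩ hz0

/-- The tangent line at a smooth point of the unit circle supports the unit ball. -/
lemma one_le_N_add_smul_deriv {s : ℝ} (hs : s ∉ range P.t) (h : ℝ) :
    1 ≤ N (P.u s + h • deriv P.u s) := by
  by_contra hlt
  push Not at hlt
  -- by convexity, a deficit `δ` at parameter `h` gives a deficit `ε δ` at `ε h`, which is too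
  -- large for a tangent line
  set δ := 1 - N (P.u s + h • deriv P.u s) with hδ
  have hδ0 : 0 < δ := by linarith
  set K := N (1, 0) + N (0, 1) with hK
  have hK0 : 0 ≤ K := add_nonneg (apply_nonneg _ _) (apply_nonneg _ _)
  have hNK : ∀ x, N x ≤ K * ‖x‖ := by
    intro x
    have hx : x = x.1 • ((1, 0) : ℝ × ℝ) + x.2 • ((0, 1) : ℝ × ℝ) := by ext <;> simp
    calc N x = N (x.1 • ((1, 0) : ℝ × ℝ) + x.2 • ((0, 1) : ℝ × ℝ)) := by rw [← hx]
      _ ≤ ‖x.1‖ * N (1, 0) + ‖x.2‖ * N (0, 1) := by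
        refine (map_add_le_add N _ _).trans ?_
        rw [map_smul_eq_mul, map_smul_eq_mul]
      _ ≤ ‖x‖ * N (1, 0) + ‖x‖ * N (0, 1) := by
        have h1 := norm_fst_le x
        have h2 := norm_snd_le x
        have := apply_nonneg N ((1, 0) : ℝ × ℝ)
        have := apply_nonneg N ((0, 1) : ℝ × ℝ)
        gcongr
      _ = K * ‖x‖ := by rw [hK]; ring
  set c := δ / (2 * (K + 1) * (|h| + 1)) with hc
  have hh := abs_nonneg h
  have hc0 : 0 < c := by positivity
  have hlo := (hasDerivAt_iff_isLittleO_nhds_zero.1 (P.hasDerivAt_u hs)).def hc0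
  have htend : Filter.Tendsto (fun ε : ℝ => ε * h) (nhdsWithin 0 (Ioi 0)) (nhds 0) := by
    have : Continuous fun ε : ℝ => ε * h := by fun_prop
    simpa using (this.tendsto 0).mono_left nhdsWithin_le_nhds
  obtain ⟨ε, hε, hεm⟩ := ((htend.eventually hlo).and
    (Ioo_mem_nhdsGT (zero_lt_one' ℝ))).exists
  have h1 : N (P.u s + (ε * h) • deriv P.u s) ≤ 1 - ε * δ := by
    have : P.u s + (ε * h) • deriv P.u s =
        (1 - ε) • P.u s + ε • (P.u s + h • deriv P.u s) := by
      rw [smul_add, smul_smul, sub_smul, one_smul]; abel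
    rw [this]
    refine (map_add_le_add N _ _).trans ?_
    rw [map_smul_eq_mul, map_smul_eq_mul, P.N_u, Real.norm_of_nonneg hεm.1.le,
      Real.norm_of_nonneg (by linarith [hεm.2])]
    rw [hδ]; apply le_of_eq; ring
  have h2 : 1 ≤ N (P.u s + (ε * h) • deriv P.u s) +
      N (P.u (s + ε * h) - P.u s - (ε * h) • deriv P.u s) := by
    rw [← P.N_u (s + ε * h)]
    refine le_trans (le_of_eq ?_) (map_add_le_add N _ _)
    congr 1; abel
  have h3 := (hNK (P.u (s + ε * h) - P.u s - (ε * h) • deriv P.u s)).trans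
    (mul_le_mul_of_nonneg_left hε hK0)
  rw [norm_mul, Real.norm_of_nonneg hεm.1.le, Real.norm_eq_abs] at h3
  have h4 : K * (c * (ε * |h|)) < ε * δ := by
    have h5 : c * (2 * (K + 1) * (|h| + 1)) = δ := by rw [hc]; field_simp
    have h6 : K * c * |h| < δ := by
      rw [← h5]
      have : K * |h| < 2 * (K + 1) * (|h| + 1) := by nlinarith [mul_nonneg hK0 hh]
      nlinarith
    nlinarith [mul_lt_mul_of_pos_left h6 hεm.1]
  linarith

lemma abs_det_deriv_le {s : ℝ} (hs : s ∉ range P.t) {x : ℝ × ℝ} (hx : N x = 1) :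
    |det x (deriv P.u s)| ≤ det (P.u s) (deriv P.u s) := by
  have key : ∀ x, N x = 1 → det x (deriv P.u s) ≤ det (P.u s) (deriv P.u s) := by
    intro x hx
    have hp := P.det_u_deriv_pos hs
    set l := det x (deriv P.u s) with hl
    rcases le_or_gt l 0 with h0 | h0
    · linarith
    have hxe : (det (P.u s) (deriv P.u s) / l) • x =
        P.u s + (det (P.u s) x / l) • deriv P.u s := by
      rw [← sub_eq_zero]
      refine eq_zero_of_det_eq_zero hp.ne' ?_ ?_
      · rw [det_sub_left, det_add_left, det_smul_left, det_smul_left, det_self,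
          det_comm x, det_comm (deriv P.u s)]; ring
      · rw [det_sub_left, det_add_left, det_smul_left, det_smul_left, det_self, ← hl]
        field_simp; ring
    have h1 := P.one_le_N_add_smul_deriv hs (det (P.u s) x / l)
    rw [← hxe, map_smul_eq_mul, hx, mul_one, Real.norm_of_nonneg (by positivity),
      le_div_iff₀ h0, one_mul] at h1
    exact h1
  refine abs_le.2 ⟨?_, key x hx⟩
  have := key (-x) (by rw [map_neg_eq_map, hx])
  rw [det_neg_left] at this
  linarith

/-- The tangent direction of the unit circle turns counterclockwise. -/
lemma det_deriv_deriv_nonneg {s t : ℝ} (hs : s ∉ range P.t) (ht : t ∉ range P.t) (hst : s < t)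
    (hts : t < s + P.T) : 0 ≤ det (deriv P.u s) (deriv P.u t) := by
  have h1 := P.abs_det_deriv_le hs (P.N_u t)
  have h2 := P.abs_det_deriv_le ht (P.N_u s)
  have h3 := P.det_u_u_pos hs hst hts
  -- the Plücker relation expresses `[u'(s), u'(t)]` through the two supporting lines
  have h4 : det (P.u s) (P.u t) * det (deriv P.u s) (deriv P.u t) =
      det (P.u s) (deriv P.u s) * det (P.u t) (deriv P.u t) -
        det (P.u t) (deriv P.u s) * det (P.u s) (deriv P.u t) := by
    simp only [det]; ring
  have h5 : det (P.u t) (deriv P.u s) * det (P.u s) (deriv P.u t) ≤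
      det (P.u s) (deriv P.u s) * det (P.u t) (deriv P.u t) :=
    (le_abs_self _).trans (by rw [abs_mul]; gcongr; exact (P.det_u_deriv_pos hs).le)
  have h6 : 0 ≤ det (P.u s) (P.u t) * det (deriv P.u s) (deriv P.u t) := by rw [h4]; linarith
  exact nonneg_of_mul_nonneg_right h6 h3

end UnitCircle

/-! ### The area inequality for curves closed up to a tangent vector -/

namespace UnitCircle

variable {N : Seminorm ℝ (ℝ × ℝ)} (P : UnitCircle N)

/-- The Plücker relation between four vectors of the plane. -/
lemma det_mul_det (e d x y : ℝ × ℝ) :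
    det e d * det x y = det e x * det d y - det d x * det e y := by
  simp only [det]; ring

/-- A curve with velocity `q u'`, `q` of any sign, over half a period of the unit circle has
nonpositive signed area, relative to its starting point, if its chord is parallel to the initial
direction `u'(s₀)`. -/
theorem integral_det_nonpos {m : ℝ → ℝ × ℝ} {q : ℝ → ℝ} {s₀ : ℝ} (hs₀ : s₀ ∉ range P.t)
    (hm : Continuous m) (hm' : ∀ t ∉ range P.t, HasDerivAt m (q t • deriv P.u t) t)
    (hint : IntervalIntegrable (fun t => q t • deriv P.u t) volume s₀ (s₀ + P.T))
    (hclose : det (m (s₀ + P.T) - m s₀) (deriv P.u s₀) = 0) :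
    ∫ t in s₀..s₀ + P.T, det (m t - m s₀) (q t • deriv P.u t) ≤ 0 := by
  have hT := P.T_pos
  set e := P.u s₀ with he
  set d := deriv P.u s₀ with hd
  have hp : 0 < det e d := P.det_u_deriv_pos hs₀
  have hcont : ∀ w : ℝ × ℝ, Continuous fun t => det w (m t - m s₀) := fun w =>
    continuous_det.comp (continuous_const.prodMk (hm.sub continuous_const))
  have hderiv : ∀ w : ℝ × ℝ, ∀ t ∉ range P.t,
      HasDerivAt (fun t => det w (m t - m s₀)) (q t * det w (deriv P.u t)) t := by
    intro w t ht
    have := (hasDerivAt_const t w).det ((hm' t ht).sub_const (m s₀))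
    simpa [det_zero_left, det_smul_right] using this
  have hmeas : ∀ w : ℝ × ℝ, Measurable fun t => det w (deriv P.u t) := fun w =>
    measurable_det.comp (measurable_const.prodMk (measurable_deriv P.u))
  have hintw : ∀ w : ℝ × ℝ,
      IntervalIntegrable (fun t => q t * det w (deriv P.u t)) volume s₀ (s₀ + P.T) := by
    intro w
    have h1 := (hint.1.fst.const_mul w.2)
    have h2 := (hint.1.snd.const_mul w.1)
    rw [intervalIntegrable_iff_integrableOn_Ioc_of_le (by linarith)]
    refine (h2.sub h1).congr (Filter.Eventually.of_forall fun t => ?_)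
    simp [det]; ring
  have hXα : det d (m s₀ - m s₀) = 0 := by simp [det]
  have hXβ : det d (m (s₀ + P.T) - m s₀) = 0 := by rw [det_comm, hclose, neg_zero]
  -- `(X, Y) = ([d, m - m s₀], [e, m - m s₀])` are coordinates that reverse the orientation
  have hcore : 0 ≤ ∫ t in s₀..s₀ + P.T, det d (m t - m s₀) * (q t * det e (deriv P.u t)) := by
    refine integral_mul_nonneg_of_antitone_slope (a := fun t => det d (deriv P.u t))
      (by linarith) P.countable_range_t (hmeas d) (hmeas e) ?_ ?_
      (hcont d).continuousOn (fun t ht => hderiv d t ht.2) hXα hXβ (hintw d) (hintw e)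
    · rintro t ⟨ht, htC⟩
      exact P.det_deriv_deriv_nonneg hs₀ htC ht.1 ht.2
    · rintro s ⟨hs, hsC⟩ t ⟨ht, htC⟩ hst
      have h1 := P.det_deriv_deriv_nonneg hsC htC hst (by linarith [hs.1, ht.2])
      have h2 := det_mul_det e d (deriv P.u s) (deriv P.u t)
      have h3 := mul_nonneg hp.le h1
      linarith
  have i1 : IntervalIntegrable
      (fun t => q t * det d (deriv P.u t) * det e (m t - m s₀)) volume s₀ (s₀ + P.T) :=
    (hintw d).mul_continuousOn (hcont e).continuousOn
  have i2 : IntervalIntegrable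
      (fun t => det d (m t - m s₀) * (q t * det e (deriv P.u t))) volume s₀ (s₀ + P.T) :=
    (hintw e).continuousOn_mul (hcont d).continuousOn
  have hparts := P.integral_eq_sub_of_hasDerivAt ((hcont d).mul (hcont e))
    (fun t ht => (hderiv d t ht).mul (hderiv e t ht)) (i1.add i2)
  simp only [Pi.mul_apply, hXα, hXβ, zero_mul, sub_zero] at hparts
  rw [intervalIntegral.integral_add i1 i2] at hparts
  have hfin : det e d * ∫ t in s₀..s₀ + P.T, det (m t - m s₀) (q t • deriv P.u t) =
      (∫ t in s₀..s₀ + P.T, q t * det d (deriv P.u t) * det e (m t - m s₀)) -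
      ∫ t in s₀..s₀ + P.T, det d (m t - m s₀) * (q t * det e (deriv P.u t)) := by
    rw [← intervalIntegral.integral_sub i1 i2, ← intervalIntegral.integral_const_mul]
    congr 1
    ext t
    rw [det_mul_det, det_smul_right, det_smul_right]
    ring
  have : det e d * ∫ t in s₀..s₀ + P.T, det (m t - m s₀) (q t • deriv P.u t) ≤ 0 := by
    rw [hfin]; linarith
  exact nonpos_of_mul_nonpos_right this hp

end UnitCircle

/-! ### The area of the unit ball -/

namespace UnitCircle

variable {N : Seminorm ℝ (ℝ × ℝ)} (P : UnitCircle N)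

lemma integrable_det_u (a b : ℝ) :
    IntervalIntegrable (fun s => det (P.u s) (deriv P.u s)) volume a b :=
  P.arcwiseSmooth_u.intervalIntegrable_det P P.periodic_u P.continuous_u a b

lemma periodic_det_u : Function.Periodic (fun s => det (P.u s) (deriv P.u s)) P.T :=
  periodic_det_deriv_of_odd P.u_add

/-- Polar coordinates adapted to the unit circle. -/
def polarMap (z : ℝ × ℝ) : ℝ × ℝ := z.1 • P.u z.2

/-- The derivative of `polarMap` at a point over a smooth point of the unit circle. -/
noncomputable def polarMapDeriv (z : ℝ × ℝ) : ℝ × ℝ →L[ℝ] ℝ × ℝ :=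
  (Matrix.toLin (.finTwoProd ℝ) (.finTwoProd ℝ)
    !![(P.u z.2).1, z.1 * (deriv P.u z.2).1;
      (P.u z.2).2, z.1 * (deriv P.u z.2).2]).toContinuousLinearMap

lemma hasFDerivAt_polarMap {z : ℝ × ℝ} (hz : z.2 ∉ range P.t) :
    HasFDerivAt P.polarMap (P.polarMapDeriv z) z := by
  have h := (hasFDerivAt_fst (𝕜 := ℝ) (p := z)).smul
    ((P.hasDerivAt_u hz).hasFDerivAt.comp z hasFDerivAt_snd)
  convert! h using 1
  unfold polarMapDeriv
  rw [Matrix.toLin_finTwoProd_toContinuousLinearMap]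
  ext <;> simp

lemma det_polarMapDeriv (z : ℝ × ℝ) :
    (P.polarMapDeriv z).det = z.1 * det (P.u z.2) (deriv P.u z.2) := by
  unfold polarMapDeriv
  simp only [ContinuousLinearMap.det, LinearMap.coe_toContinuousLinearMap, LinearMap.det_toLin,
    Matrix.det_fin_two_of, det]
  ring

lemma measurableSet_range_t : MeasurableSet (range P.t) := P.countable_range_t.measurableSet

lemma injOn_polarMap : InjOn P.polarMap (Ioc 0 1 ×ˢ (Ioo 0 (2 * P.T) \ range P.t)) := by
  rintro ⟨r, s⟩ ⟨hr, hs⟩ ⟨r', s'⟩ ⟨hr', hs'⟩ h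
  simp only [polarMap] at h hr hr' hs hs'
  have hN := congrArg N h
  rw [map_smul_eq_mul, map_smul_eq_mul, P.N_u, P.N_u, mul_one, mul_one,
    Real.norm_of_nonneg hr.1.le, Real.norm_of_nonneg hr'.1.le] at hN
  subst hN
  have h2 := smul_right_injective (ℝ × ℝ) hr.1.ne' h
  rw [P.injOn ⟨hs.1.1.le, hs.1.2⟩ ⟨hs'.1.1.le, hs'.1.2⟩ h2]

/-- Polar coordinates cover the unit ball up to the centre and the rays through the vertices. -/
lemma polarMap_image_ae_eq (hN : ∀ x, N x = 0 → x = 0) :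
    P.polarMap '' (Ioc 0 1 ×ˢ (Ioo 0 (2 * P.T) \ range P.t)) =ᵐ[volume] N.closedBall 0 1 := by
  have hT : 0 < 2 * P.T := by linarith [P.T_pos]
  refine Filter.EventuallyLE.antisymm (Filter.Eventually.of_forall ?_) ?_
  · rintro _ ⟨⟨r, s⟩, ⟨hr, hs⟩, rfl⟩
    change P.polarMap (r, s) ∈ N.closedBall 0 1
    simp only at hr
    rw [Seminorm.mem_closedBall_zero, polarMap, map_smul_eq_mul, P.N_u, mul_one,
      Real.norm_of_nonneg hr.1.le]
    exact hr.2
  · have hline : ∀ᵐ x : ℝ × ℝ, ∀ i : ℤ, x ∉ Submodule.span ℝ {P.u (P.t i)} := by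
      rw [ae_all_iff]
      intro i
      refine measure_eq_zero_iff_ae_notMem.1 (Measure.addHaar_submodule volume _ fun h => ?_)
      have h1 := finrank_span_singleton (K := ℝ) (P.u_ne_zero (P.t i))
      rw [h, finrank_top, Module.finrank_prod, Module.finrank_self] at h1
      norm_num at h1
    filter_upwards [hline] with x hx hxN
    change x ∈ P.polarMap '' (Ioc 0 1 ×ˢ (Ioo 0 (2 * P.T) \ range P.t))
    replace hxN : x ∈ N.closedBall 0 1 := hxN
    rw [Seminorm.mem_closedBall_zero] at hxN
    have hx0 : 0 < N x := by
      refine lt_of_le_of_ne (apply_nonneg _ _) fun h => ?_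
      rw [hN x h.symm] at hx
      exact hx 0 (Submodule.zero_mem _)
    have hmem : (N x)⁻¹ • x ∈ range P.u := by
      rw [P.range_eq, mem_ofPred_eq, map_smul_eq_mul, norm_inv, Real.norm_of_nonneg hx0.le,
        inv_mul_cancel₀ hx0.ne']
    obtain ⟨s, hs⟩ := hmem
    have hxs : x = N x • P.u s := by rw [hs, smul_smul, mul_inv_cancel₀ hx0.ne', one_smul]
    obtain ⟨s', hs', hss'⟩ := P.periodic_u.exists_mem_Ico₀ hT s
    rw [hss'] at hxs
    have hr : s' ∉ range P.t := by
      rintro ⟨i, rfl⟩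
      exact hx i (Submodule.mem_span_singleton.2 ⟨N x, hxs.symm⟩)
    refine ⟨(N x, s'), ⟨⟨hx0, hxN⟩, ⟨lt_of_le_of_ne hs'.1 fun h => hr ⟨0, ?_⟩, hs'.2⟩, hr⟩,
      hxs.symm⟩
    rw [P.t_zero, h]

theorem unitBallArea_eq (hN : ∀ x, N x = 0 → x = 0) :
    unitBallArea N = ∫ s in (0 : ℝ)..P.T, det (P.u s) (deriv P.u s) := by
  have hT := P.T_pos
  set S : Set (ℝ × ℝ) := Ioc 0 1 ×ˢ (Ioo 0 (2 * P.T) \ range P.t) with hS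
  have hSm : MeasurableSet S :=
    measurableSet_Ioc.prod (measurableSet_Ioo.diff P.measurableSet_range_t)
  have h1 := integral_image_eq_integral_abs_det_fderiv_smul volume hSm
    (fun z (hz : z ∈ S) => (P.hasFDerivAt_polarMap hz.2.2).hasFDerivWithinAt) P.injOn_polarMap
    (fun _ => (1 : ℝ))
  have h2 : ∫ z in S, |(P.polarMapDeriv z).det| • (1 : ℝ) =
      ∫ z in S, z.1 * det (P.u z.2) (deriv P.u z.2) := by
    refine setIntegral_congr_fun hSm fun z hz => ?_
    simp only [P.det_polarMapDeriv, smul_eq_mul, mul_one]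
    exact abs_of_nonneg (mul_nonneg hz.1.1.le (P.det_u_deriv_pos hz.2.2).le)
  rw [h2, hS, Measure.volume_eq_prod, setIntegral_prod_mul (fun r : ℝ => r)
    (fun s => det (P.u s) (deriv P.u s)), ← Measure.volume_eq_prod] at h1
  have h3 : ∫ r in Ioc (0 : ℝ) 1, r = 1 / 2 := by
    rw [← intervalIntegral.integral_of_le zero_le_one, integral_id]; norm_num
  have h4 : ∫ s in Ioo 0 (2 * P.T) \ range P.t, det (P.u s) (deriv P.u s) =
      2 * ∫ s in (0 : ℝ)..P.T, det (P.u s) (deriv P.u s) := by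
    rw [← integral_two_mul_of_periodic P.periodic_det_u hT (P.integrable_det_u _ _),
      intervalIntegral.integral_of_le (by linarith),
      setIntegral_congr_set (sdiff_null_ae_eq_self (P.countable_range_t.measure_zero volume)),
      integral_Ioc_eq_integral_Ioo]
  rw [h3, h4, setIntegral_const, smul_eq_mul, mul_one, 
    measureReal_congr (P.polarMap_image_ae_eq hN)] at h1
  unfold unitBallArea
  change volume.real _ = _
  rw [h1]; ring

lemma integral_det_u_pos : 0 < ∫ s in (0 : ℝ)..P.T, det (P.u s) (deriv P.u s) := by
  classical
  -- the integrand is modified at the break points, where the derivative is a junk value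
  set g : ℝ → ℝ := fun s => if s ∈ range P.t then 1 else det (P.u s) (deriv P.u s) with hg
  have hae : ∀ᵐ s : ℝ, det (P.u s) (deriv P.u s) = g s := by
    filter_upwards [P.ae_notMem_range_t] with s hs
    simp only [hg, if_neg hs]
  rw [intervalIntegral.integral_congr_ae (hae.mono fun s h _ => h)]
  refine intervalIntegral.intervalIntegral_pos_of_pos
    ((P.integrable_det_u _ _).congr_ae (ae_restrict_of_ae hae)) (fun s => ?_) P.T_pos
  by_cases h : s ∈ range P.t
  · simp only [hg, if_pos h, zero_lt_one]
  · simp only [hg, if_neg h, P.det_u_deriv_pos h]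

end UnitCircle

/-! ### Curves parallel to the tangent vectors -/

namespace UnitCircle

variable {N : Seminorm ℝ (ℝ × ℝ)} (P : UnitCircle N)

lemma deriv_u_ne_zero {s : ℝ} (hs : s ∉ range P.t) : deriv P.u s ≠ 0 := fun h => by
  have := P.det_u_deriv_pos hs
  rw [h] at this
  simp [det] at this

lemma isLinearArc_add_n {i : ℤ} (h : P.IsLinearArc i) : P.IsLinearArc (i + P.n) := by
  unfold IsLinearArc at *
  have e1 : P.t (i + P.n + 1) = P.t (i + 1) + P.T := by
    rw [show i + (P.n : ℤ) + 1 = i + 1 + P.n by ring, P.t_add]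
  rw [e1, P.t_add, P.u_add, P.u_add, ← image_add_const_Icc, image_image]
  simp only [P.u_add]
  rw [← image_image (fun x => -x) P.u, h]
  exact image_segment ℝ (-LinearMap.id : (ℝ × ℝ) →ₗ[ℝ] (ℝ × ℝ)).toAffineMap _ _

/-- The chord of an arc does not degenerate. -/
lemma chord_ne_zero (i : ℤ) : P.u (P.t (i + 1)) - P.u (P.t i) ≠ 0 := by
  intro h
  have hlt := P.t_lt i
  have hle : P.t (i + 1) ≤ P.t i + P.T := by
    rw [← P.t_add]
    have := P.n_pos
    exact P.t_strictMono.monotone (by omega)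
  have := P.eq_of_u_eq (sub_eq_zero.1 h) (by rw [abs_lt]; constructor <;> linarith [P.T_pos])
  linarith

lemma det_chord_deriv_eq_zero {i : ℤ} (h : P.IsLinearArc i) {s : ℝ}
    (hs : s ∈ Ioo (P.t i) (P.t (i + 1))) :
    det (P.u (P.t (i + 1)) - P.u (P.t i)) (deriv P.u s) = 0 := by
  set D := P.u (P.t (i + 1)) - P.u (P.t i) with hD
  have h0 : ∀ x ∈ Icc (P.t i) (P.t (i + 1)), det D (P.u x - P.u (P.t i)) = 0 := by
    intro x hx
    have hx' : P.u x ∈ segment ℝ (P.u (P.t i)) (P.u (P.t (i + 1))) := by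
      have : P.u x ∈ P.u '' Icc (P.t i) (P.t (i + 1)) := ⟨x, hx, rfl⟩
      rwa [show P.u '' Icc (P.t i) (P.t (i + 1)) = _ from h] at this
    rw [segment_eq_image'] at hx'
    obtain ⟨θ, -, hθ⟩ := hx'
    rw [← hθ, ← hD, add_sub_cancel_left, det_smul_right, det_self, mul_zero]
  have h1 := (hasDerivAt_const s D).det
    ((P.hasDerivAt_u (P.notMem_range_of_mem_Ioo hs)).sub_const (P.u (P.t i)))
  rw [det_zero_left, zero_add] at h1
  refine h1.unique ((hasDerivAt_const s (0 : ℝ)).congr_of_eventuallyEq ?_)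
  filter_upwards [Icc_mem_nhds hs.1 hs.2] with x hx using h0 x hx

lemma det_deriv_deriv_deriv_ne_zero {i : ℤ} (h : ¬ P.IsLinearArc i) {s : ℝ}
    (hs : s ∈ Ioo (P.t i) (P.t (i + 1))) : det (deriv P.u s) (deriv (deriv P.u) s) ≠ 0 := by
  have h1 := (P.linear_or_curved i).resolve_left h s (Ioo_subset_Icc_self hs)
  rw [ArcwiseSmooth.derivWithin_eq hs, iteratedDerivWithin_succ,
    derivWithin_of_mem_nhds (Icc_mem_nhds hs.1 hs.2)] at h1
  have h2 : deriv (iteratedDerivWithin 1 P.u (Icc (P.t i) (P.t (i + 1)))) s =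
      deriv (deriv P.u) s := by
    refine Filter.EventuallyEq.deriv_eq ?_
    filter_upwards [Ioo_mem_nhds hs.1 hs.2] with x hx
    rw [iteratedDerivWithin_one, ArcwiseSmooth.derivWithin_eq hx]
  rwa [h2] at h1

lemma eqOn_zero_Icc_of_Ioo {g : ℝ → ℝ} (hg : Continuous g) {i : ℤ}
    (h : ∀ s ∈ Ioo (P.t i) (P.t (i + 1)), g s = 0) :
    ∀ s ∈ Icc (P.t i) (P.t (i + 1)), g s = 0 := by
  intro s hs
  rw [← closure_Ioo (P.t_lt i).ne] at hs
  exact closure_minimal (t := {x | g x = 0}) h (isClosed_eq hg continuous_const) hs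

/-- A curve `f` with `f' = q u'` that is everywhere parallel to `u'`, with `q` constant on the
straight arcs, vanishes.  On curved arcs this follows by differentiating `[f, u'] = 0`; then `f`
vanishes at all break points, by the vertex condition between two straight arcs; on a straight
arc it cannot leave the origin and come back with constant `q ≠ 0`. -/
theorem eq_zero_of_det_deriv_eq_zero {f : ℝ → ℝ × ℝ} {q : ℝ → ℝ} (hf : Continuous f)
    (hf' : ∀ s ∉ range P.t, HasDerivAt f (q s • deriv P.u s) s)
    (hq : ∀ i, P.IsLinearArc i → ∃ k : ℝ, ∀ s ∈ Ioo (P.t i) (P.t (i + 1)), q s = k)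
    (h : ∀ s ∉ range P.t, det (f s) (deriv P.u s) = 0) (s : ℝ) : f s = 0 := by
  have hdet : ∀ w : ℝ × ℝ, Continuous fun s => det (f s) w := fun w =>
    continuous_det.comp (hf.prodMk continuous_const)
  have hcurved : ∀ i, ¬ P.IsLinearArc i → ∀ s ∈ Icc (P.t i) (P.t (i + 1)), f s = 0 := by
    intro i hi
    have hin : ∀ s ∈ Ioo (P.t i) (P.t (i + 1)), f s = 0 := by
      intro s hs
      have hs' := P.notMem_range_of_mem_Ioo hs
      have h1 := (hf' s hs').det (P.arcwiseSmooth_u.hasDerivAt_deriv hs')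
      have h2 : det (q s • deriv P.u s) (deriv P.u s) + det (f s) (deriv (deriv P.u) s) = 0 := by
        refine h1.unique ((hasDerivAt_const s (0 : ℝ)).congr_of_eventuallyEq ?_)
        filter_upwards [Ioo_mem_nhds hs.1 hs.2] with x hx
        exact h x (P.notMem_range_of_mem_Ioo hx)
      rw [det_smul_left, det_self, mul_zero, zero_add] at h2
      exact eq_zero_of_det_eq_zero (P.det_deriv_deriv_deriv_ne_zero hi hs) (h s hs') h2
    intro s hs
    rw [← closure_Ioo (P.t_lt i).ne] at hs
    exact closure_minimal (t := {x | f x = 0}) hin (isClosed_eq hf continuous_const) hs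
  have hlinear : ∀ i, P.IsLinearArc i → ∀ s ∈ Icc (P.t i) (P.t (i + 1)),
      det (f s) (P.u (P.t (i + 1)) - P.u (P.t i)) = 0 := by
    intro i hi
    refine P.eqOn_zero_Icc_of_Ioo (hdet _) fun s hs => ?_
    have hs' := P.notMem_range_of_mem_Ioo hs
    by_contra hne
    refine P.deriv_u_ne_zero hs' (eq_zero_of_det_eq_zero hne ?_ ?_)
    · rw [det_comm, h s hs', neg_zero]
    · rw [det_comm, P.det_chord_deriv_eq_zero hi hs, neg_zero]
  have hbreak : ∀ i, f (P.t (i + 1)) = 0 := by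
    intro i
    have hlt := P.t_lt i
    have hlt' := P.t_lt (i + 1)
    by_cases h1 : P.IsLinearArc i
    · by_cases h2 : P.IsLinearArc (i + 1)
      · have e : i + 1 + 1 = i + 2 := by ring
        have h3 := hlinear i h1 _ ⟨hlt.le, le_rfl⟩
        have h4 := hlinear (i + 1) h2 _ ⟨le_rfl, hlt'.le⟩
        unfold IsLinearArc at h1 h2
        rw [e] at h2 h4
        exact eq_zero_of_det_eq_zero (P.vertex i h1 h2) h3 h4
      · exact hcurved _ h2 _ ⟨le_rfl, hlt'.le⟩
    · exact hcurved _ h1 _ ⟨hlt.le, le_rfl⟩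
  obtain ⟨i, hi⟩ := P.exists_mem_Ico s
  by_cases hl : P.IsLinearArc i
  · obtain ⟨k, hk⟩ := hq i hl
    have hti : f (P.t i) = 0 := by simpa using hbreak (i - 1)
    have hconst : ∀ x ∈ Icc (P.t i) (P.t (i + 1)),
        f x - k • P.u x = f (P.t i) - k • P.u (P.t i) := by
      intro x hx
      have := intervalIntegral.integral_eq_sub_of_hasDerivAt_of_le (f := fun y => f y - k • P.u y)
        (f' := fun _ => 0) hx.1 (hf.sub (P.continuous_u.const_smul k)).continuousOn
        (fun y hy => by
          have hy' : y ∈ Ioo (P.t i) (P.t (i + 1)) := ⟨hy.1, hy.2.trans_le hx.2⟩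
          have hyr := P.notMem_range_of_mem_Ioo hy'
          have h1 := (hf' y hyr).sub ((P.hasDerivAt_u hyr).const_smul k)
          rw [hk y hy', sub_self] at h1
          exact h1) intervalIntegrable_const
      simp only [intervalIntegral.integral_zero] at this
      exact (sub_eq_zero.1 this.symm)
    have h1 := hconst _ ⟨(P.t_lt i).le, le_rfl⟩
    rw [hbreak, hti, zero_sub, zero_sub, neg_inj, ← sub_eq_zero, ← smul_sub] at h1
    have hk0 : k = 0 := (smul_eq_zero.1 h1).resolve_right (P.chord_ne_zero i)
    have h2 := hconst s ⟨hi.1, hi.2.le⟩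
    simpa [hk0, hti] using h2
  · exact hcurved i hl s ⟨hi.1, hi.2.le⟩

lemma intervalIntegrable_of_le_continuous {E : Type*} [NormedAddCommGroup E] {g : ℝ → E}
    (hg : AEStronglyMeasurable g) {G : ℝ → ℝ} (hG : Continuous G)
    (hle : ∀ s ∉ range P.t, ‖g s‖ ≤ G s) (a b : ℝ) : IntervalIntegrable g volume a b := by
  refine (hG.intervalIntegrable a b).mono_fun hg.restrict ?_
  filter_upwards [ae_restrict_of_ae P.ae_notMem_range_t] with s hs
  exact (hle s hs).trans (le_abs_self _)

lemma ArcwiseSmooth.intervalIntegrable_deriv {f : ℝ → ℝ × ℝ} (hf : P.ArcwiseSmooth f)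
    (hper : Function.Periodic f (2 * P.T)) (a b : ℝ) :
    IntervalIntegrable (deriv f) volume a b := by
  obtain ⟨M, -, hM⟩ := hf.bounded_deriv P hper
  exact P.intervalIntegrable_of_le_continuous (measurable_deriv f).aestronglyMeasurable
    continuous_const hM a b

/-- The area inequality `integral_det_nonpos` for arcwise smooth curves. -/
lemma ArcwiseSmooth.integral_det_le {f : ℝ → ℝ × ℝ} (hf : P.ArcwiseSmooth f)
    (hper : Function.Periodic f (2 * P.T)) {q : ℝ → ℝ}
    (hf' : ∀ s ∉ range P.t, deriv f s = q s • deriv P.u s) {s₀ : ℝ} (hs₀ : s₀ ∉ range P.t)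
    (hclose : det (f (s₀ + P.T) - f s₀) (deriv P.u s₀) = 0) :
    ∫ s in s₀..s₀ + P.T, det (f s) (deriv f s) ≤ det (f s₀) (f (s₀ + P.T)) := by
  have hae : ∀ᵐ s : ℝ, deriv f s = q s • deriv P.u s := by
    filter_upwards [P.ae_notMem_range_t] with s hs using hf' s hs
  have hint := hf.intervalIntegrable_deriv P hper s₀ (s₀ + P.T)
  have h1 := P.integral_det_nonpos hs₀ hf.continuous
    (fun t ht => by rw [← hf' t ht]; exact hf.hasDerivAt ht)
    (hint.congr_ae (ae_restrict_of_ae hae)) hclose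
  have h2 : ∫ t in s₀..s₀ + P.T, det (f t - f s₀) (q t • deriv P.u t) =
      ∫ t in s₀..s₀ + P.T, (det (f t) (deriv f t) - det (f s₀) (deriv f t)) := by
    refine intervalIntegral.integral_congr_ae (hae.mono fun t ht _ => ?_)
    rw [ht, det_sub_left]
  rw [h2, intervalIntegral.integral_sub
    (hf.intervalIntegrable_det P hper hf.continuous _ _)
    (hf.intervalIntegrable_det P hper continuous_const _ _)] at h1
  have h3 := P.integral_eq_sub_of_hasDerivAt (f := fun s => det (f s₀) (f s))
    (continuous_det.comp (continuous_const.prodMk hf.continuous))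
    (fun s hs => (hasDerivAt_const s (f s₀)).det (hf.hasDerivAt hs))
    (by simpa [det_zero_left] using
      hf.intervalIntegrable_det P hper continuous_const s₀ (s₀ + P.T))
  simp only [det_zero_left, zero_add, det_self, sub_zero] at h3
  linarith

end UnitCircle

/-! ### The odd part: areas, mixed area and constant width -/

namespace AdmissibleCurve

variable {N : Seminorm ℝ (ℝ × ℝ)} {P : UnitCircle N} (c : AdmissibleCurve P)

lemma arcwiseSmooth_γ : P.ArcwiseSmooth c.γ := c.smooth

lemma γ_add_two (s : ℝ) : c.γ (s + P.T + P.T) = c.γ s := by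
  rw [add_assoc, ← two_mul, c.periodic]

lemma hasDerivAt_γ {s : ℝ} (hs : s ∉ range P.t) : HasDerivAt c.γ (c.r s • deriv P.u s) s := by
  obtain ⟨i, hi⟩ := P.exists_mem_Ioo hs
  rw [← c.deriv_eq i s hi]
  exact c.arcwiseSmooth_γ.hasDerivAt hs

lemma hasDerivAt_γ_add {s : ℝ} (hs : s ∉ range P.t) :
    HasDerivAt (fun s => c.γ (s + P.T)) (-(c.r (s + P.T) • deriv P.u s)) s := by
  have h := c.hasDerivAt_γ (fun h => hs (P.add_T_mem_range_iff.1 h))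
  rw [P.deriv_u_add, smul_neg] at h
  exact h.comp_add_const s P.T

/-- The odd part of the curve, `(γ(s) - γ(s + T)) / 2`. -/
noncomputable def oddPart (s : ℝ) : ℝ × ℝ := (1 / 2 : ℝ) • (c.γ s - c.γ (s + P.T))

/-- The curvature radius of `oddPart`. -/
noncomputable def oddRadius (s : ℝ) : ℝ := (c.r s + c.r (s + P.T)) / 2

/-- The curvature radius of the Wigner caustic. -/
noncomputable def evenRadius (s : ℝ) : ℝ := (c.r s - c.r (s + P.T)) / 2

lemma arcwiseSmooth_oddPart : P.ArcwiseSmooth c.oddPart :=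
  (c.arcwiseSmooth_γ.sub c.arcwiseSmooth_γ.comp_add_T).const_smul _

lemma arcwiseSmooth_wignerCaustic : P.ArcwiseSmooth c.wignerCaustic :=
  (c.arcwiseSmooth_γ.add c.arcwiseSmooth_γ.comp_add_T).const_smul _

lemma oddPart_add (s : ℝ) : c.oddPart (s + P.T) = -c.oddPart s := by
  rw [oddPart, oddPart, c.γ_add_two, ← smul_neg, neg_sub]

lemma wignerCaustic_add (s : ℝ) : c.wignerCaustic (s + P.T) = c.wignerCaustic s := by
  rw [wignerCaustic, wignerCaustic, c.γ_add_two, add_comm]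

lemma deriv_oddPart {s : ℝ} (hs : s ∉ range P.t) :
    deriv c.oddPart s = c.oddRadius s • deriv P.u s := by
  have h := ((c.hasDerivAt_γ hs).sub (c.hasDerivAt_γ_add hs)).const_smul (1 / 2 : ℝ)
  refine (HasDerivAt.deriv (f := c.oddPart) h).trans ?_
  rw [oddRadius, sub_neg_eq_add, ← add_smul, smul_smul]
  congr 1; ring

lemma deriv_wignerCaustic {s : ℝ} (hs : s ∉ range P.t) :
    deriv c.wignerCaustic s = c.evenRadius s • deriv P.u s := by
  have h := ((c.hasDerivAt_γ hs).add (c.hasDerivAt_γ_add hs)).const_smul (1 / 2 : ℝ)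
  refine (HasDerivAt.deriv (f := c.wignerCaustic) h).trans ?_
  rw [evenRadius, ← sub_eq_add_neg, ← sub_smul, smul_smul]
  congr 1; ring

lemma integrable_det_oddPart {g : ℝ → ℝ × ℝ} (hg : Continuous g) (a b : ℝ) :
    IntervalIntegrable (fun s => det (g s) (deriv c.oddPart s)) volume a b :=
  c.arcwiseSmooth_oddPart.intervalIntegrable_det P (periodic_two_mul c.oddPart_add) hg a b

lemma periodic_wignerCaustic : Function.Periodic c.wignerCaustic P.T := c.wignerCaustic_add

lemma periodic_two_wignerCaustic : Function.Periodic c.wignerCaustic (2 * P.T) := by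
  have := c.periodic_wignerCaustic.nat_mul 2
  exact_mod_cast this

lemma integrable_det_wignerCaustic {g : ℝ → ℝ × ℝ} (hg : Continuous g) (a b : ℝ) :
    IntervalIntegrable (fun s => det (g s) (deriv c.wignerCaustic s)) volume a b :=
  c.arcwiseSmooth_wignerCaustic.intervalIntegrable_det P c.periodic_two_wignerCaustic hg a b

lemma continuous_oddPart : Continuous c.oddPart := c.arcwiseSmooth_oddPart.continuous

lemma continuous_wignerCaustic : Continuous c.wignerCaustic :=
  c.arcwiseSmooth_wignerCaustic.continuous

/-- Twice the signed area of the Wigner caustic. -/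
noncomputable def evenIntegral : ℝ :=
  ∫ s in (0 : ℝ)..P.T, det (c.wignerCaustic s) (deriv c.wignerCaustic s)

/-- The signed area of the odd part: both halves of its period contribute equally. -/
noncomputable def oddIntegral : ℝ := ∫ s in (0 : ℝ)..P.T, det (c.oddPart s) (deriv c.oddPart s)

/-- The (signed) mixed area of the unit ball and the odd part. -/
noncomputable def mixedIntegral : ℝ := ∫ s in (0 : ℝ)..P.T, det (P.u s) (deriv c.oddPart s)

/-- The mixed terms of `[γ, γ']` cancel between `s` and `s + T`. -/
theorem area_eq : c.area = c.evenIntegral + c.oddIntegral := by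
  have hint := c.arcwiseSmooth_γ.intervalIntegrable_det P c.periodic c.arcwiseSmooth_γ.continuous
  unfold area signedArea
  rw [integral_zero_two_mul hint, evenIntegral, oddIntegral, ← intervalIntegral.integral_add
    (c.integrable_det_wignerCaustic c.continuous_wignerCaustic _ _)
    (c.integrable_det_oddPart c.continuous_oddPart _ _), ← intervalIntegral.integral_const_mul]
  refine intervalIntegral.integral_congr_ae ?_
  filter_upwards [P.ae_notMem_range_t] with s hs _
  have hsT : s + P.T ∉ range P.t := fun h => hs (P.add_T_mem_range_iff.1 h)
  rw [c.deriv_oddPart hs, c.deriv_wignerCaustic hs, (c.hasDerivAt_γ hs).deriv,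
    (c.hasDerivAt_γ hsT).deriv, P.deriv_u_add]
  simp only [oddPart, wignerCaustic, oddRadius, evenRadius, det_smul_left, det_smul_right,
    det_neg_right, det_add_left, det_sub_left]
  ring

lemma wignerCausticArea_eq : c.wignerCausticArea = c.evenIntegral / 2 := by
  unfold wignerCausticArea signedArea evenIntegral
  ring

theorem dualLength_eq : c.dualLength = 2 * c.mixedIntegral := by
  have hae : ∀ᵐ s : ℝ, det (P.u s) (deriv c.γ s) = c.r s * det (P.u s) (deriv P.u s) := by
    filter_upwards [P.ae_notMem_range_t] with s hs
    rw [(c.hasDerivAt_γ hs).deriv, det_smul_right]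
  have hint : ∀ a b, IntervalIntegrable (fun s => c.r s * det (P.u s) (deriv P.u s))
      volume a b := fun a b =>
    (c.arcwiseSmooth_γ.intervalIntegrable_det P c.periodic P.continuous_u a b).congr_ae
      (ae_restrict_of_ae hae)
  unfold dualLength
  rw [integral_zero_two_mul hint, mixedIntegral, ← intervalIntegral.integral_const_mul]
  refine intervalIntegral.integral_congr_ae ?_
  filter_upwards [P.ae_notMem_range_t] with s hs _
  rw [c.deriv_oddPart hs, P.u_add, P.deriv_u_add]
  simp only [oddRadius, det_smul_right, det_neg_right, det_neg_left]
  ring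

lemma integral_det_oddPart_u :
    ∫ s in (0 : ℝ)..P.T, det (c.oddPart s) (deriv P.u s) = c.mixedIntegral := by
  have i1 := c.integrable_det_oddPart P.continuous_u 0 P.T
  have i2 := P.arcwiseSmooth_u.intervalIntegrable_det P P.periodic_u c.continuous_oddPart 0 P.T
  have h := P.integral_eq_sub_of_hasDerivAt (f := fun s => det (c.oddPart s) (P.u s))
    (f' := fun s => det (c.oddPart s) (deriv P.u s) - det (P.u s) (deriv c.oddPart s))
    (continuous_det.comp (c.continuous_oddPart.prodMk P.continuous_u))
    (fun s hs => by
      have := (c.arcwiseSmooth_oddPart.hasDerivAt hs).det (P.hasDerivAt_u hs)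
      rwa [det_comm _ (P.u s), neg_add_eq_sub] at this) (i2.sub i1)
  have hT := c.oddPart_add 0
  have hu := P.u_add 0
  rw [zero_add] at hT hu
  rw [intervalIntegral.integral_sub i2 i1, hT, hu, det_neg_left, det_neg_right, neg_neg,
    sub_self] at h
  unfold mixedIntegral
  linarith

/-- The odd part minus a multiple of the unit circle. -/
noncomputable def oddDiff (k s : ℝ) : ℝ × ℝ := c.oddPart s - k • P.u s

lemma arcwiseSmooth_oddDiff (k : ℝ) : P.ArcwiseSmooth (c.oddDiff k) :=
  c.arcwiseSmooth_oddPart.sub (P.arcwiseSmooth_u.const_smul k)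

lemma oddDiff_add (k s : ℝ) : c.oddDiff k (s + P.T) = -c.oddDiff k s := by
  rw [oddDiff, oddDiff, c.oddPart_add, P.u_add, smul_neg]; abel

lemma deriv_oddDiff (k : ℝ) {s : ℝ} (hs : s ∉ range P.t) :
    deriv (c.oddDiff k) s = deriv c.oddPart s - k • deriv P.u s :=
  ((c.arcwiseSmooth_oddPart.hasDerivAt hs).sub ((P.hasDerivAt_u hs).const_smul k)).deriv

/-- The area of `o - k u` as a quadratic polynomial in `k`. -/
theorem integral_det_oddDiff (k : ℝ) :
    ∫ s in (0 : ℝ)..P.T, det (c.oddDiff k s) (deriv (c.oddDiff k) s) =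
      c.oddIntegral - 2 * k * c.mixedIntegral +
        k ^ 2 * ∫ s in (0 : ℝ)..P.T, det (P.u s) (deriv P.u s) := by
  have i1 := c.integrable_det_oddPart P.continuous_u 0 P.T
  have i2 := P.arcwiseSmooth_u.intervalIntegrable_det P P.periodic_u c.continuous_oddPart 0 P.T
  have i3 := c.integrable_det_oddPart c.continuous_oddPart 0 P.T
  have i4 := P.integrable_det_u 0 P.T
  have h : ∫ s in (0 : ℝ)..P.T, det (c.oddDiff k s) (deriv (c.oddDiff k) s) =
      ∫ s in (0 : ℝ)..P.T, (det (c.oddPart s) (deriv c.oddPart s) -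
        k * det (c.oddPart s) (deriv P.u s) - k * det (P.u s) (deriv c.oddPart s) +
        k ^ 2 * det (P.u s) (deriv P.u s)) := by
    refine intervalIntegral.integral_congr_ae ?_
    filter_upwards [P.ae_notMem_range_t] with s hs _
    rw [c.deriv_oddDiff k hs, oddDiff]
    simp only [det_sub_left, det_sub_right, det_smul_left, det_smul_right]
    ring
  rw [h, intervalIntegral.integral_add ((i3.sub (i2.const_mul k)).sub (i1.const_mul k))
    (i4.const_mul _), intervalIntegral.integral_sub (i3.sub (i2.const_mul k)) (i1.const_mul k),
    intervalIntegral.integral_sub i3 (i2.const_mul k), intervalIntegral.integral_const_mul,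
    intervalIntegral.integral_const_mul, intervalIntegral.integral_const_mul,
    integral_det_oddPart_u, oddIntegral, mixedIntegral]
  ring

theorem cwmsArea_eq (hN : ∀ x, N x = 0 → x = 0) :
    c.cwmsArea = c.oddIntegral - c.mixedIntegral ^ 2 / unitBallArea N := by
  have hU := P.unitBallArea_eq hN
  have hpos : 0 < unitBallArea N := hU ▸ P.integral_det_u_pos
  have hc : c.cwms = c.oddDiff (c.mixedIntegral / unitBallArea N) := by
    funext s
    rw [cwms, oddDiff, oddPart, meanWidth, dualLength_eq, smul_sub, smul_smul]
    congr 2; ring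
  rw [cwmsArea, signedArea, hc, integral_two_mul_of_periodic
    (periodic_det_deriv_of_odd (c.oddDiff_add _)) P.T_pos
    ((c.arcwiseSmooth_oddDiff _).intervalIntegrable_det P
      (periodic_two_mul (c.oddDiff_add _)) (c.arcwiseSmooth_oddDiff _).continuous _ _),
    integral_det_oddDiff, ← hU]
  field_simp
  ring

/-- The family of quadratic inequalities behind the Minkowski inequality for the odd part. -/
theorem oddIntegral_sub_le (s₀ : ℝ) (hs₀ : s₀ ∉ range P.t) :
    c.oddIntegral - 2 * det (c.oddPart s₀) (P.v s₀) * c.mixedIntegral +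
      det (c.oddPart s₀) (P.v s₀) ^ 2 * ∫ s in (0 : ℝ)..P.T, det (P.u s) (deriv P.u s) ≤ 0 := by
  set k := det (c.oddPart s₀) (P.v s₀) with hk
  have hper := periodic_det_deriv_of_odd (c.oddDiff_add k)
  have hp := P.det_u_deriv_pos hs₀
  have h := (c.arcwiseSmooth_oddDiff k).integral_det_le P (periodic_two_mul (c.oddDiff_add k))
    (q := fun s => c.oddRadius s - k)
    (fun s hs => by rw [c.deriv_oddDiff k hs, c.deriv_oddPart hs, sub_smul]) hs₀ (by
      rw [c.oddDiff_add, det_sub_left, det_neg_left, oddDiff, det_sub_left, det_smul_left, hk,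
        UnitCircle.v, det_smul_right]
      field_simp
      ring)
  rw [hper.intervalIntegral_add_eq s₀ 0, zero_add, integral_det_oddDiff, c.oddDiff_add,
    det_neg_right, det_self, neg_zero] at h
  exact h

lemma hasConstantWidth_iff :
    c.HasConstantWidth ↔ ∃ k, ∀ s ∉ range P.t, det (c.oddPart s) (P.v s) = k := by
  have key : ∀ s, det (c.γ (s + P.T)) (P.v (s + P.T)) + det (c.γ s) (P.v s) =
      2 * det (c.oddPart s) (P.v s) := by
    intro s
    rw [UnitCircle.v, UnitCircle.v, P.u_add, P.deriv_u_add, oddPart]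
    simp only [det_smul_left, det_smul_right, det_neg_left, det_neg_right, det_sub_left, neg_neg]
    ring
  constructor
  · rintro ⟨w, hw⟩
    refine ⟨w / 2, fun s hs => ?_⟩
    obtain ⟨i, hi⟩ := P.exists_mem_Ioo hs
    have := hw i s hi
    rw [key] at this
    linarith
  · rintro ⟨k, hk⟩
    refine ⟨2 * k, fun i s hs => ?_⟩
    rw [key, hk s (P.notMem_range_of_mem_Ioo hs)]

lemma exists_notMem_range_t : ∃ s, s ∉ range P.t :=
  ⟨(P.t 0 + P.t 1) / 2, P.notMem_range_of_mem_Ioo (i := 0) (by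
    have := P.t_lt 0
    rw [zero_add] at *
    constructor <;> linarith)⟩

/-- Minkowski's inequality for the mixed area of the unit ball and the odd part. -/
theorem oddIntegral_le (hN : ∀ x, N x = 0 → x = 0) :
    c.oddIntegral ≤ c.mixedIntegral ^ 2 / unitBallArea N := by
  have hU := P.unitBallArea_eq hN
  have hpos : 0 < unitBallArea N := hU ▸ P.integral_det_u_pos
  obtain ⟨s, hs⟩ := exists_notMem_range_t (P := P)
  have h := c.oddIntegral_sub_le s hs
  rw [← hU] at h
  rw [le_div_iff₀ hpos]
  nlinarith [sq_nonneg (c.mixedIntegral - det (c.oddPart s) (P.v s) * unitBallArea N)]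

theorem oddIntegral_eq_iff (hN : ∀ x, N x = 0 → x = 0) :
    c.oddIntegral = c.mixedIntegral ^ 2 / unitBallArea N ↔ c.HasConstantWidth := by
  have hU := P.unitBallArea_eq hN
  have hpos : 0 < unitBallArea N := hU ▸ P.integral_det_u_pos
  rw [hasConstantWidth_iff]
  constructor
  · intro h
    refine ⟨c.mixedIntegral / unitBallArea N, fun s hs => ?_⟩
    have h1 := c.oddIntegral_sub_le s hs
    rw [← hU, h] at h1
    have h2 : (c.mixedIntegral / unitBallArea N - det (c.oddPart s) (P.v s)) ^ 2 *
        unitBallArea N ≤ 0 := by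
      refine le_trans (le_of_eq ?_) h1
      field_simp
      ring
    have h3 := nonpos_of_mul_nonpos_left h2 hpos
    have h4 := pow_eq_zero_iff (two_ne_zero) |>.1 (le_antisymm h3 (sq_nonneg _))
    linarith
  · rintro ⟨k, hk⟩
    have hk' : ∀ᵐ s : ℝ, det (c.oddPart s) (deriv P.u s) = k * det (P.u s) (deriv P.u s) := by
      filter_upwards [P.ae_notMem_range_t] with s hs
      have hp := P.det_u_deriv_pos hs
      rw [← hk s hs, UnitCircle.v, det_smul_right]
      field_simp
    have h1 : c.mixedIntegral = k * unitBallArea N := by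
      rw [← integral_det_oddPart_u, hU, ← intervalIntegral.integral_const_mul]
      exact intervalIntegral.integral_congr_ae (hk'.mono fun s h _ => h)
    have h2 : c.oddIntegral = k * c.mixedIntegral := by
      rw [oddIntegral, mixedIntegral, ← intervalIntegral.integral_const_mul]
      refine intervalIntegral.integral_congr_ae ?_
      filter_upwards [P.ae_notMem_range_t, hk'] with s hs h _
      rw [c.deriv_oddPart hs, det_smul_right, det_smul_right, h]
      ring
    rw [h2, h1]
    field_simp

end AdmissibleCurve

/-! ### The Wigner caustic: sign of its area and symmetry -/

namespace AdmissibleCurve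

variable {N : Seminorm ℝ (ℝ × ℝ)} {P : UnitCircle N} (c : AdmissibleCurve P)

lemma periodic_det_wignerCaustic :
    Function.Periodic (fun s => det (c.wignerCaustic s) (deriv c.wignerCaustic s)) P.T := by
  intro s
  simp only [c.wignerCaustic_add, c.periodic_wignerCaustic.deriv' s]

lemma evenIntegral_eq (s₀ : ℝ) :
    c.evenIntegral = ∫ s in s₀..s₀ + P.T, det (c.wignerCaustic s) (deriv c.wignerCaustic s) := by
  rw [c.periodic_det_wignerCaustic.intervalIntegral_add_eq s₀ 0, zero_add, evenIntegral]

/-- The Wigner caustic closes up after half a period, so the area inequality applies to it. -/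
theorem evenIntegral_nonpos : c.evenIntegral ≤ 0 := by
  obtain ⟨s, hs⟩ := exists_notMem_range_t (P := P)
  have h := c.arcwiseSmooth_wignerCaustic.integral_det_le P c.periodic_two_wignerCaustic
    (fun s hs => c.deriv_wignerCaustic hs) hs (by
      rw [c.wignerCaustic_add, sub_self, det_zero_left])
  rwa [c.wignerCaustic_add, det_self, ← c.evenIntegral_eq] at h

lemma eq_zero_of_forall_add_sq_nonpos {x y : ℝ} (h : ∀ ε : ℝ, ε * x + ε ^ 2 * y ≤ 0) : x = 0 := by
  by_contra hx
  have hx2 : 0 < x ^ 2 := by positivity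
  have hy : 0 < |y| + 1 := by positivity
  have h1 := h (x / (|y| + 1))
  have h2 : x / (|y| + 1) * x + (x / (|y| + 1)) ^ 2 * y =
      x ^ 2 / (|y| + 1) ^ 2 * (|y| + 1 + y) := by field_simp
  rw [h2] at h1
  have h3 : 0 < |y| + 1 + y := by linarith [neg_abs_le y]
  have : 0 < x ^ 2 / (|y| + 1) ^ 2 * (|y| + 1 + y) := by positivity
  linarith

/-- If the Wigner caustic has zero area, it is a maximizer of the nonpositive area form, hence it
is orthogonal, for the polar form, to every variation along the arcs. -/
lemma integral_variation_eq_zero (hE : c.evenIntegral = 0) {s₀ : ℝ} (hs₀ : s₀ ∉ range P.t)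
    {φ : ℝ → ℝ} (hφ : ∀ s ∉ range P.t, ContinuousAt φ s) (hφm : Measurable φ)
    (hint : ∀ a b, IntervalIntegrable (fun s => φ s • deriv P.u s) volume a b)
    (hz : ∫ s in s₀..s₀ + P.T, φ s * det (deriv P.u s₀) (deriv P.u s) = 0) :
    ∫ s in s₀..s₀ + P.T,
      φ s * det (c.wignerCaustic s - c.wignerCaustic s₀) (deriv P.u s) = 0 := by
  set e : ℝ → ℝ × ℝ := fun s => c.wignerCaustic s - c.wignerCaustic s₀ with he
  set e' : ℝ → ℝ × ℝ := deriv c.wignerCaustic with he'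
  set f : ℝ → ℝ × ℝ := fun s => ∫ x in s₀..s, φ x • deriv P.u x with hf
  have hfc : Continuous f := intervalIntegral.continuous_primitive hint s₀
  have hec : Continuous e := c.continuous_wignerCaustic.sub continuous_const
  have hf0 : f s₀ = 0 := intervalIntegral.integral_same
  have he0 : e s₀ = 0 := sub_self _
  have heT : e (s₀ + P.T) = 0 := by simp only [he, c.wignerCaustic_add, sub_self]
  have hmeas : Measurable fun s => φ s • deriv P.u s := hφm.smul (measurable_deriv P.u)
  have hf' : ∀ s ∉ range P.t, HasDerivAt f (φ s • deriv P.u s) s := fun s hs =>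
    intervalIntegral.integral_hasDerivAt_right (hint _ _)
      hmeas.stronglyMeasurable.stronglyMeasurableAtFilter
      ((hφ s hs).smul (P.arcwiseSmooth_u.hasDerivAt_deriv hs).continuousAt)
  have he'' : ∀ s ∉ range P.t, HasDerivAt e (e' s) s := fun s hs =>
    (c.arcwiseSmooth_wignerCaustic.hasDerivAt hs).sub_const _
  have hdetint : ∀ {g : ℝ → ℝ × ℝ}, Continuous g → ∀ a b,
      IntervalIntegrable (fun s => det (g s) (φ s • deriv P.u s)) volume a b := by
    intro g hg a b
    have h1 := (hint a b)
    have h2 := (intervalIntegrable_iff.1 h1).fst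
    have h3 := (intervalIntegrable_iff.1 h1).snd
    have h4 := (intervalIntegrable_iff.2 h3).continuousOn_mul (g := fun s => (g s).1)
      (continuous_fst.comp hg).continuousOn
    have h5 := (intervalIntegrable_iff.2 h2).continuousOn_mul (g := fun s => (g s).2)
      (continuous_snd.comp hg).continuousOn
    exact h4.sub h5
  set b := s₀ + P.T with hb
  have j1 := c.integrable_det_wignerCaustic hec s₀ b
  have j2 := hdetint hec s₀ b
  have j3 := c.integrable_det_wignerCaustic hfc s₀ b
  have j4 := hdetint hfc s₀ b
  have hfb : det (f b) (deriv P.u s₀) = 0 := by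
    have hi := hdetint (g := fun _ => deriv P.u s₀) continuous_const s₀ b
    have h1 := P.integral_eq_sub_of_hasDerivAt (f := fun s => det (deriv P.u s₀) (f s))
      (continuous_det.comp (continuous_const.prodMk hfc))
      (fun s hs => (hasDerivAt_const s (deriv P.u s₀)).det (hf' s hs))
      (by simpa [det_zero_left] using hi)
    simp only [det_zero_left, zero_add, det_smul_right, hf0] at h1
    rw [det_comm, ← neg_zero, neg_inj]
    rw [show det (deriv P.u s₀) 0 = 0 by simp [det], sub_zero] at h1
    rw [← h1]
    exact hz
  -- the first integral vanishes by hypothesis, and the two mixed terms agree by parts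
  have hJ1 : ∫ s in s₀..b, det (e s) (e' s) = 0 := by
    have h1 := P.integral_eq_sub_of_hasDerivAt
      (f := fun s => det (c.wignerCaustic s₀) (c.wignerCaustic s))
      (continuous_det.comp (continuous_const.prodMk c.continuous_wignerCaustic))
      (fun s hs => (hasDerivAt_const s (c.wignerCaustic s₀)).det
        (c.arcwiseSmooth_wignerCaustic.hasDerivAt hs))
      (by simpa [det_zero_left] using c.integrable_det_wignerCaustic continuous_const s₀ b)
    simp only [det_zero_left, zero_add, hb, c.wignerCaustic_add, sub_self] at h1
    simp only [he, det_sub_left]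
    rw [intervalIntegral.integral_sub
      (c.integrable_det_wignerCaustic c.continuous_wignerCaustic _ _)
      (c.integrable_det_wignerCaustic continuous_const _ _), ← c.evenIntegral_eq, hE, h1, sub_zero]
  have hJ23 : ∫ s in s₀..b, det (f s) (e' s) = ∫ s in s₀..b, det (e s) (φ s • deriv P.u s) := by
    have h1 := P.integral_eq_sub_of_hasDerivAt (f := fun s => det (f s) (e s))
      (f' := fun s => det (f s) (e' s) - det (e s) (φ s • deriv P.u s))
      (continuous_det.comp (hfc.prodMk hec))
      (fun s hs => by
        have := (hf' s hs).det (he'' s hs)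
        rwa [det_comm _ (e s), neg_add_eq_sub] at this) (j3.sub j2)
    rw [intervalIntegral.integral_sub j3 j2, heT, hf0, he0] at h1
    simp only [det, Prod.fst_zero, Prod.snd_zero, mul_zero, sub_zero] at h1
    exact sub_eq_zero.1 h1
  -- the area inequality for `e + ε f`, expanded in powers of `ε`
  have hvar : ∀ ε : ℝ, ε * (2 * ∫ s in s₀..b, det (e s) (φ s • deriv P.u s)) +
      ε ^ 2 * ∫ s in s₀..b, det (f s) (φ s • deriv P.u s) ≤ 0 := by
    intro ε
    have hae : ∀ s ∉ range P.t, e' s + ε • (φ s • deriv P.u s) =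
        (c.evenRadius s + ε * φ s) • deriv P.u s := fun s hs => by
      rw [add_smul, ← smul_smul, he', c.deriv_wignerCaustic hs]
    have hi : IntervalIntegrable (fun s => e' s + ε • (φ s • deriv P.u s)) volume s₀ b :=
      (c.arcwiseSmooth_wignerCaustic.intervalIntegrable_deriv P
        c.periodic_two_wignerCaustic s₀ b).add ((hint s₀ b).smul ε)
    have h1 := P.integral_det_nonpos (m := fun s => e s + ε • f s)
      (q := fun s => c.evenRadius s + ε * φ s) hs₀ (hec.add (hfc.const_smul ε))
      (fun s hs => by
        rw [← hae s hs]
        exact (he'' s hs).add ((hf' s hs).const_smul ε))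
      (hi.congr_ae (ae_restrict_of_ae (P.ae_notMem_range_t.mono hae)))
      (by
        change det (e b + ε • f b - (e s₀ + ε • f s₀)) (deriv P.u s₀) = 0
        rw [heT, hf0, he0, smul_zero, add_zero, sub_zero, zero_add, det_smul_left, hfb, mul_zero])
    have h2 : ∫ s in s₀..b, det (e s + ε • f s - (e s₀ + ε • f s₀))
          ((c.evenRadius s + ε * φ s) • deriv P.u s) =
        ∫ s in s₀..b, (det (e s) (e' s) + ε * det (e s) (φ s • deriv P.u s) +
          ε * det (f s) (e' s) + ε ^ 2 * det (f s) (φ s • deriv P.u s)) := by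
      refine intervalIntegral.integral_congr_ae ?_
      filter_upwards [P.ae_notMem_range_t] with s hs _
      rw [← hae s hs, hf0, he0, smul_zero, add_zero, sub_zero, det_add_left, det_add_right,
        det_add_right]
      simp only [det_smul_left, det_smul_right]
      ring
    rw [h2, intervalIntegral.integral_add ((j1.add (j2.const_mul ε)).add (j3.const_mul ε))
      (j4.const_mul _), intervalIntegral.integral_add (j1.add (j2.const_mul ε)) (j3.const_mul ε),
      intervalIntegral.integral_add j1 (j2.const_mul ε), intervalIntegral.integral_const_mul,
      intervalIntegral.integral_const_mul, intervalIntegral.integral_const_mul, hJ1, hJ23] at h1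
    linarith
  have h := eq_zero_of_forall_add_sq_nonpos hvar
  simp only [det_smul_right] at h
  linarith

lemma measurable_det_deriv_u {g : ℝ → ℝ × ℝ} (hg : Continuous g) :
    Measurable fun s => det (g s) (deriv P.u s) :=
  measurable_det.comp (hg.measurable.prodMk (measurable_deriv P.u))

lemma continuousAt_det_deriv_u {g : ℝ → ℝ × ℝ} (hg : Continuous g) {s : ℝ} (hs : s ∉ range P.t) :
    ContinuousAt (fun s => det (g s) (deriv P.u s)) s :=
  continuous_det.continuousAt.comp (f := fun s => (g s, deriv P.u s)) (hg.continuousAt.prodMk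
    (P.arcwiseSmooth_u.hasDerivAt_deriv hs).continuousAt)

/-- If the Wigner caustic has zero area, some translate of it is everywhere parallel to `u'`. -/
lemma exists_det_sub_eq_zero (hE : c.evenIntegral = 0) :
    ∃ p : ℝ × ℝ, ∀ s ∉ range P.t, det (c.wignerCaustic s - p) (deriv P.u s) = 0 := by
  obtain ⟨s₀, hs₀⟩ := exists_notMem_range_t (P := P)
  have hT := P.T_pos
  obtain ⟨M, hM0, hM⟩ := P.arcwiseSmooth_u.bounded_deriv P P.periodic_u
  set d := deriv P.u s₀ with hd
  set e : ℝ → ℝ × ℝ := fun s => c.wignerCaustic s - c.wignerCaustic s₀ with he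
  have hec : Continuous e := c.continuous_wignerCaustic.sub continuous_const
  set k : ℝ → ℝ := fun s => det (e s) (deriv P.u s) with hk
  set a : ℝ → ℝ := fun s => det d (deriv P.u s) with ha
  have hprod : ∀ g h : ℝ → ℝ × ℝ, Continuous g → Continuous h → ∀ x y, IntervalIntegrable
      (fun s => det (g s) (deriv P.u s) * det (h s) (deriv P.u s)) volume x y := by
    intro g h hg hh
    refine P.intervalIntegrable_of_le_continuous
      ((measurable_det_deriv_u hg).mul (measurable_det_deriv_u hh)).aestronglyMeasurable
      (G := fun s => (2 * (‖g s‖ * M)) * (2 * (‖h s‖ * M))) (by fun_prop) fun s hs => ?_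
    rw [norm_mul, Real.norm_eq_abs, Real.norm_eq_abs]
    have h1 := abs_det_le (g s) (deriv P.u s)
    have h2 := abs_det_le (h s) (deriv P.u s)
    have h3 := hM s hs
    gcongr
    · exact h1.trans (by gcongr)
    · exact h2.trans (by gcongr)
  have hka := hprod e (fun _ => d) hec continuous_const s₀ (s₀ + P.T)
  have haa := hprod (fun _ => d) (fun _ => d) continuous_const continuous_const s₀ (s₀ + P.T)
  -- `∫ a = [d, -2 u s₀] ≠ 0`, so `a` is not almost everywhere zero
  have hapos : (∫ s in s₀..s₀ + P.T, a s * a s) ≠ 0 := by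
    intro h0
    have h1 : (fun s => a s * a s) =ᵐ[volume.restrict (Ioc s₀ (s₀ + P.T))] 0 := by
      rw [intervalIntegral.integral_eq_zero_iff_of_le_of_nonneg_ae (by linarith)
        (Filter.Eventually.of_forall fun s => mul_self_nonneg (a s)) haa] at h0
      exact h0
    have h2 : ∫ s in s₀..s₀ + P.T, a s = 0 := by
      rw [intervalIntegral.integral_of_le (by linarith)]
      refine integral_eq_zero_of_ae (h1.mono fun s hs => ?_)
      simpa using hs
    have h3 := P.integral_eq_sub_of_hasDerivAt (f := fun s => det d (P.u s))
      (continuous_det.comp (continuous_const.prodMk P.continuous_u))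
      (fun s hs => (hasDerivAt_const s d).det (P.hasDerivAt_u hs))
      (by simpa [det_zero_left] using P.arcwiseSmooth_u.intervalIntegrable_det P P.periodic_u
            continuous_const s₀ (s₀ + P.T))
    simp only [det_zero_left, zero_add] at h3
    change ∫ s in s₀..s₀ + P.T, a s = _ at h3
    have h4 := P.det_u_deriv_pos hs₀
    rw [h2, P.u_add, det_neg_right, det_comm] at h3
    linarith
  -- the coefficient makes `k - κ a` orthogonal to `a`
  set κ := (∫ s in s₀..s₀ + P.T, k s * a s) / ∫ s in s₀..s₀ + P.T, a s * a s with hκ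
  set p := c.wignerCaustic s₀ + κ • d with hp
  set φ : ℝ → ℝ := fun s => det (c.wignerCaustic s - p) (deriv P.u s) with hφ
  have hgc : Continuous fun s => c.wignerCaustic s - p :=
    c.continuous_wignerCaustic.sub continuous_const
  have hφk : ∀ s, φ s = k s - κ * a s := by
    intro s
    simp only [hφ, hk, ha, he, hp, ← sub_sub, det_sub_left _ (κ • d), det_smul_left]
  have hint : ∀ x y, IntervalIntegrable (fun s => φ s • deriv P.u s) volume x y := by
    refine P.intervalIntegrable_of_le_continuous
      ((measurable_det_deriv_u hgc).smul (measurable_deriv P.u)).aestronglyMeasurable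
      (G := fun s => 2 * (‖c.wignerCaustic s - p‖ * M) * M) (by fun_prop) fun s hs => ?_
    rw [norm_smul, Real.norm_eq_abs]
    have h1 := abs_det_le (c.wignerCaustic s - p) (deriv P.u s)
    have h3 := hM s hs
    gcongr
    exact h1.trans (by gcongr)
  have hz : ∫ s in s₀..s₀ + P.T, φ s * a s = 0 := by
    simp only [hφk, sub_mul, mul_assoc]
    rw [intervalIntegral.integral_sub hka (haa.const_mul κ), intervalIntegral.integral_const_mul,
      hκ, div_mul_cancel₀ _ hapos, sub_self]
  have hv := c.integral_variation_eq_zero hE hs₀ (fun s hs => continuousAt_det_deriv_u hgc hs)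
    (measurable_det_deriv_u hgc) hint hz
  have hφφ : ∫ s in s₀..s₀ + P.T, φ s * φ s = 0 := by
    have h1 := hprod _ _ hgc hec s₀ (s₀ + P.T)
    have h2 := hprod _ (fun _ => d) hgc continuous_const s₀ (s₀ + P.T)
    have : ∀ s, φ s * φ s = φ s * k s - κ * (φ s * a s) := fun s => by rw [hφk]; ring
    simp only [this]
    rw [intervalIntegral.integral_sub h1 (h2.const_mul κ), intervalIntegral.integral_const_mul, hz]
    rw [mul_zero, sub_zero]
    exact hv
  rw [intervalIntegral.integral_eq_zero_iff_of_le_of_nonneg_ae (by linarith)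
    (Filter.Eventually.of_forall fun s => mul_self_nonneg (φ s))
    (hprod _ _ hgc hgc _ _)] at hφφ
  refine ⟨p, ?_⟩
  have hbase : ∀ s ∈ Ioo s₀ (s₀ + P.T), s ∉ range P.t → φ s = 0 := by
    intro s hs hsr
    obtain ⟨i, hi⟩ := P.exists_mem_Ioo hsr
    have hcont : ContinuousOn φ (Ioo s₀ (s₀ + P.T) ∩ Ioo (P.t i) (P.t (i + 1))) := fun x hx =>
      (continuousAt_det_deriv_u hgc (P.notMem_range_of_mem_Ioo hx.2)).continuousWithinAt
    have h1 := Measure.eqOn_open_of_ae_eq (μ := volume) (f := fun s => φ s * φ s)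
      (g := fun _ => (0 : ℝ)) (ae_restrict_of_ae_restrict_of_subset
        (inter_subset_left.trans Ioo_subset_Ioc_self) hφφ)
      (isOpen_Ioo.inter isOpen_Ioo) (hcont.mul hcont) continuousOn_const ⟨hs, hi⟩
    simpa using h1
  have hperiod : Function.Periodic (fun s => s ∉ range P.t → φ s = 0) P.T := by
    intro s
    simp only [P.add_T_mem_range_iff, hφ, c.wignerCaustic_add, P.deriv_u_add, det_neg_right,
      neg_eq_zero]
  intro s
  obtain ⟨s', hs', hss'⟩ := hperiod.exists_mem_Ico hT s s₀
  change s ∉ range P.t → φ s = 0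
  rw [hss']
  intro hr
  rcases hs'.1.eq_or_lt with h | h
  · rw [← h, hφk]
    simp only [hk, ha, he, hd, sub_self, det_zero_left, det_self, mul_zero]
  · exact hbase s' ⟨h, hs'.2⟩ hr

lemma evenRadius_const_of_isLinearArc (i : ℤ) (hi : P.IsLinearArc i) :
    ∃ k : ℝ, ∀ s ∈ Ioo (P.t i) (P.t (i + 1)), c.evenRadius s = k := by
  obtain ⟨k, hk⟩ := c.linear_const i hi
  obtain ⟨l, hl⟩ := c.linear_const _ (P.isLinearArc_add_n hi)
  refine ⟨(k - l) / 2, fun s hs => ?_⟩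
  rw [evenRadius, hk s hs, hl (s + P.T)]
  rw [show i + (P.n : ℤ) + 1 = i + 1 + P.n by ring, P.t_add, P.t_add]
  exact ⟨by linarith [hs.1], by linarith [hs.2]⟩

theorem evenIntegral_eq_zero_iff : c.evenIntegral = 0 ↔ c.IsSymmetric := by
  have hsymm : c.IsSymmetric ↔ ∃ p, ∀ s, c.wignerCaustic s = p := by
    refine exists_congr fun p => forall_congr' fun s => ?_
    rw [wignerCaustic]
    constructor
    · intro h
      rw [show c.γ (s + P.T) = p + p - c.γ s by rw [sub_eq_iff_eq_add.1 h]; abel,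
        add_sub_cancel, ← two_smul ℝ p, smul_smul]
      norm_num
    · intro h
      rw [← h, ← sub_eq_zero]
      ext <;> simp <;> ring
  rw [hsymm]
  constructor
  · intro hE
    obtain ⟨p, hp⟩ := c.exists_det_sub_eq_zero hE
    refine ⟨p, fun s => sub_eq_zero.1 ?_⟩
    refine P.eq_zero_of_det_deriv_eq_zero (f := fun s => c.wignerCaustic s - p)
      (c.continuous_wignerCaustic.sub continuous_const) (fun s hs => ?_)
      c.evenRadius_const_of_isLinearArc hp s
    rw [← c.deriv_wignerCaustic hs]
    exact (c.arcwiseSmooth_wignerCaustic.hasDerivAt hs).sub_const p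
  · rintro ⟨p, hp⟩
    have : c.wignerCaustic = fun _ => p := funext hp
    rw [evenIntegral, this]
    simp [det]

end AdmissibleCurve

end NormedPlane

theorem mainTheorem1 (N : Seminorm ℝ (ℝ × ℝ)) (hN : ∀ x, N x = 0 → x = 0)
    (P : NormedPlane.UnitCircle N) (c : NormedPlane.AdmissibleCurve P) (hc : c.IsConvex) :
    (c.dualLength ^ 2 / (4 * NormedPlane.unitBallArea N) ≥ c.area - c.cwmsArea ∧
      (c.dualLength ^ 2 / (4 * NormedPlane.unitBallArea N) = c.area - c.cwmsArea ↔
        c.IsSymmetric)) ∧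
    (c.dualLength ^ 2 / (4 * NormedPlane.unitBallArea N) ≥ c.area - 2 * c.wignerCausticArea ∧
      (c.dualLength ^ 2 / (4 * NormedPlane.unitBallArea N) = c.area - 2 * c.wignerCausticArea ↔
        c.HasConstantWidth)) := by
  have hL : c.dualLength ^ 2 / (4 * NormedPlane.unitBallArea N) =
      c.mixedIntegral ^ 2 / NormedPlane.unitBallArea N := by
    rw [c.dualLength_eq, mul_pow, show (2 : ℝ) ^ 2 = 4 by norm_num,
      mul_div_mul_left _ _ (by norm_num)]
  have hE := c.evenIntegral_nonpos
  have hO := c.oddIntegral_le hN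
  rw [hL, c.area_eq, c.cwmsArea_eq hN, c.wignerCausticArea_eq, ← c.evenIntegral_eq_zero_iff,
    ← c.oddIntegral_eq_iff hN]
  refine ⟨⟨by linarith, ?_⟩, by linarith, ?_⟩ <;> constructor <;> intro h <;> linarith
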